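/- Fix $c\in(0,1/2)$ and define $\psi_1,\psi_2,\psi_3:\mathbb{R}^2\to\mathbb{R}^2$ by \[\psi_1(x,y)=\tfrac12(1-x,y),\qquad \psi_2(x,y)=\tfrac12(1+x,-y),\qquad \psi_3(x,y)=(\tfrac12+cy,\,cx).\] Let $T$ be the unique non-empty compact subset of $\mathbb{R}^2$ with $T=\bigcup_{i=1}^3\psi_i(T)$. Put $S=\{1,2,3\}$, $\Sigma_n=S^n$, $\Sigma_*=\bigcup_{n\ge 0}\Sigma_n$ (with $S^0=\{\emptyset\}$), $\psi_i=\psi_{i_1}\circ\dots\circ\psi_{i_n}$ for $i\in\Sigma_n$, $V^0=\{(0,0),(1,0)\}$, $V^n=\bigcup_{i\in\Sigma_n}\psi_i(V^0)$ and $V^*=\bigcup_{n\ge 0}V^n\subseteq T$. Let $(w(i))_{i\in\Sigma_*\setminus\{\emptyset\}}$ be $[0,1]$-valued random variables on a probability space $(\Omega,\mathcal{F},P)$ such that the triples $(w(ij))_{j\in S}$, $i\in\Sigma_*$, are independent and identically distributed, and such that $w(i)\neq 0$ $P$-a.s. for every $i$. For $i=(i_1,\dots,i_n)$ let $l(i)=\prod_{m=1}^n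 w(i_1\cdots i_m)$, $l(\emptyset)=1$, and let \[R_i=\lim_{n\to\infty}\sum_{j\in\{1,2\}^n}\frac{l(ij)}{l(i)},\qquad i\in\Sigma_*.\] For $f:V^*\to\mathbb{R}$ let \[\mathcal{E}^n(f,f)=\sum_{i\in\Sigma_n}\frac{1}{l(i)R_i}\bigl(f(\psi_i(0,0))-f(\psi_i(1,0))\bigr)^2 ,\] let $\mathcal{F}^*$ be the set of those $f:V^*\to\mathbb{R}$ for which $\mathcal{E}^*(f,f)=\lim_{n\to\infty}\mathcal{E}^n(f,f)$ exists finitely, and set $R^*(x,x)=0$ and \[R^*(x,y)^{-1}=\inf\{\mathcal{E}^*(f,f): f\in\mathcal{F}^*,\ f(x)=0,\ f(y)=1\},\qquad x,y\in V^*,\ x\ne y.\] **Theorem.** Assume (A) $E(w(1)+w(2))=1$ and (B) $\sum_{i\in S}P(w(i)=1)<1$. Then the following hold $P$-almost surely. All the limits $R_i$, $i\in\Sigma_*$, exist and lie in $(0,\infty)$, and $R^*$ is a metric on $V^*$. There is a metric $R$ on $T$ such that, for all $x,y\in T$ and all sequences $(x_n)$, $(y_n)$ in $V^*$ converging to $x$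 and $y$ in the Euclidean metric, \[R(x,y)=\lim_{n\to\infty}R^*(x_n,y_n)\] (in particular, the limit exists and does not depend on the sequences). The topology induced by $R$ on $T$ is the Euclidean one. Moreover $(T,R)$ is compact and is a dendrite, that is, an arc-wise connected space containing no subset homeomorphic to the circle; and $(T,R)$ is the completion of $(V^*,R^*)$, that is, $(T,R)$ is complete, $R=R^*$ on $V^*\times V^*$, and $V^*$ is dense in $(T,R)$. -/

import Mathlib

open Filter Topology MeasureTheory ProbabilityTheory

noncomputable section

namespace RandomDendrite

/-- The Euclidean plane. -/
abbrev Plane : Type := EuclideanSpace ℝ (Fin 2)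

/-- The three contractions `ψ₁, ψ₂, ψ₃` of the plane; the letters `1, 2, 3` are `0, 1, 2 : Fin 3`. -/
def psi (c : ℝ) : Fin 3 → Plane → Plane
  | 0, p => !₂[(1 - p 0) / 2, p 1 / 2]
  | 1, p => !₂[(1 + p 0) / 2, -p 1 / 2]
  | 2, p => !₂[1 / 2 + c * p 1, c * p 0]

/-- Finite words over the alphabet `Fin 3`. -/
abbrev Word : Type := List (Fin 3)

/-- `ψ_i = ψ_{i₁} ∘ ⋯ ∘ ψ_{iₙ}` for a finite word `i`. -/
def psiWord (c : ℝ) : Word → Plane → Plane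
  | [], p => p
  | a :: i, p => psi c a (psiWord c i p)

/-- The two boundary points `(0,0)` and `(1,0)`, indexed by `0` and `1`. -/
def corner (b : Fin 2) : Plane := !₂[((b : ℕ) : ℝ), 0]

/-- `V⁰ = {(0,0), (1,0)}`. -/
def V0 : Set Plane := {corner 0, corner 1}

/-- `Vⁿ = ⋃ ψ_i(V⁰)`, the union over all words `i` of length `n`. -/
def V (c : ℝ) (n : ℕ) : Set Plane :=
  ⋃ i : Fin n → Fin 3, psiWord c (List.ofFn i) '' V0

/-- `V* = ⋃ₙ Vⁿ`. -/
def Vstar (c : ℝ) : Set Plane := ⋃ n : ℕ, V c n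

/-- `K` is a non-empty compact set with `K = ψ₁(K) ∪ ψ₂(K) ∪ ψ₃(K)`. -/
structure IsSelfSimilar (c : ℝ) (K : Set Plane) : Prop where
  nonempty : K.Nonempty
  isCompact : IsCompact K
  eq_iUnion : K = ⋃ a : Fin 3, psi c a '' K

/-- The set `T`: for `0 < c < 1/2` there is exactly one non-empty compact self-similar set
(`existsUnique_isSelfSimilar` below), and `T` is this set (`isSelfSimilar_T`). -/
def T (c : ℝ) : Set Plane := ⋃₀ {K | IsSelfSimilar c K}

theorem mem_Vstar_iff {c : ℝ} {p : Plane} :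
    p ∈ Vstar c ↔ ∃ (i : Word) (b : Fin 2), psiWord c i (corner b) = p := by
  simp only [Vstar, V, V0, Set.mem_iUnion, Set.mem_image, Set.mem_insert_iff,
    Set.mem_singleton_iff]
  constructor
  · rintro ⟨n, i, q, rfl | rfl, rfl⟩
    exacts [⟨_, 0, rfl⟩, ⟨_, 1, rfl⟩]
  · rintro ⟨i, b, rfl⟩
    refine ⟨i.length, i.get, corner b, ?_, by rw [List.ofFn_get]⟩
    fin_cases b
    exacts [Or.inl rfl, Or.inr rfl]

theorem dist_psi_le {c : ℝ} (hc : c ∈ Set.Ioo (0 : ℝ) (1 / 2)) (a : Fin 3) (p q : Plane) :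
    dist (psi c a p) (psi c a q) ≤ 1 / 2 * dist p q := by
  have h4 : c ^ 2 ≤ 1 / 4 := by nlinarith [hc.1, hc.2]
  have key : dist (psi c a p) (psi c a q) ^ 2 ≤ (1 / 2 * dist p q) ^ 2 := by
    rw [mul_pow, EuclideanSpace.dist_eq, EuclideanSpace.dist_eq,
      Real.sq_sqrt (by positivity), Real.sq_sqrt (by positivity)]
    simp only [Fin.sum_univ_two, Real.dist_eq, sq_abs]
    fin_cases a
    · simp [psi]; nlinarith
    · simp [psi]; nlinarith
    · simp [psi]
      nlinarith [mul_nonneg (sub_nonneg.2 h4) (sq_nonneg (p 0 - q 0)),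
        mul_nonneg (sub_nonneg.2 h4) (sq_nonneg (p 1 - q 1))]
  exact le_of_sq_le_sq key (by positivity)

theorem continuous_psi {c : ℝ} (hc : c ∈ Set.Ioo (0 : ℝ) (1 / 2)) (a : Fin 3) :
    Continuous (psi c a) :=
  (LipschitzWith.of_dist_le_mul (K := 1 / 2) fun p q => by
    simpa using dist_psi_le hc a p q).continuous

theorem psi_zero_corner (c : ℝ) : psi c 0 (corner 1) = corner 0 := by
  ext k; fin_cases k <;> simp [psi, corner]

theorem psi_one_corner (c : ℝ) : psi c 1 (corner 1) = corner 1 := by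
  ext k; fin_cases k <;> norm_num [psi, corner]

theorem dist_psi_corner_le {c : ℝ} (hc : c ∈ Set.Ioo (0 : ℝ) (1 / 2)) (a : Fin 3) :
    dist (psi c a (corner 1)) (corner 1) ≤ 1 := by
  rw [EuclideanSpace.dist_eq]
  refine Real.sqrt_le_iff.2 ⟨zero_le_one, ?_⟩
  simp only [Fin.sum_univ_two, Real.dist_eq, sq_abs]
  fin_cases a <;> norm_num [psi, corner]
  nlinarith [hc.1, hc.2]

theorem Vstar_eq_iUnion (c : ℝ) : Vstar c = ⋃ a : Fin 3, psi c a '' Vstar c := by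
  ext p
  simp only [Set.mem_iUnion, Set.mem_image, mem_Vstar_iff]
  constructor
  · rintro ⟨i, b, rfl⟩
    cases i with
    | nil =>
      fin_cases b
      · exact ⟨0, corner 1, ⟨[], 1, rfl⟩, psi_zero_corner c⟩
      · exact ⟨1, corner 1, ⟨[], 1, rfl⟩, psi_one_corner c⟩
    | cons a i => exact ⟨a, _, ⟨i, b, rfl⟩, rfl⟩
  · rintro ⟨a, q, ⟨i, b, rfl⟩, rfl⟩
    exact ⟨a :: i, b, rfl⟩

theorem Vstar_subset_closedBall {c : ℝ} (hc : c ∈ Set.Ioo (0 : ℝ) (1 / 2)) :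
    Vstar c ⊆ Metric.closedBall (corner 1) 2 := by
  intro p hp
  obtain ⟨i, b, rfl⟩ := mem_Vstar_iff.1 hp
  clear hp
  rw [Metric.mem_closedBall]
  induction i with
  | nil =>
    fin_cases b
    · have h := dist_psi_corner_le hc 0
      rw [psi_zero_corner] at h
      exact h.trans (by norm_num)
    · simp [psiWord]
  | cons a i ih =>
    have h1 := dist_psi_le hc a (psiWord c i (corner b)) (corner 1)
    have h2 := dist_psi_corner_le hc a
    have h3 := dist_triangle (psi c a (psiWord c i (corner b))) (psi c a (corner 1)) (corner 1)
    simp only [psiWord]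
    linarith

theorem isSelfSimilar_closure_Vstar {c : ℝ} (hc : c ∈ Set.Ioo (0 : ℝ) (1 / 2)) :
    IsSelfSimilar c (closure (Vstar c)) := by
  have hcomp : IsCompact (closure (Vstar c)) :=
    (Metric.isBounded_closedBall.subset (Vstar_subset_closedBall hc)).isCompact_closure
  refine ⟨⟨corner 1, subset_closure (mem_Vstar_iff.2 ⟨[], 1, rfl⟩)⟩, hcomp, ?_⟩
  apply Set.Subset.antisymm
  · apply closure_minimal
    · conv_lhs => rw [Vstar_eq_iUnion]
      exact Set.iUnion_mono fun a => Set.image_mono subset_closure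
    · exact isClosed_iUnion_of_finite fun a => (hcomp.image (continuous_psi hc a)).isClosed
  · refine Set.iUnion_subset fun a => ?_
    refine (image_closure_subset_closure_image (continuous_psi hc a)).trans (closure_mono ?_)
    conv_rhs => rw [Vstar_eq_iUnion]
    exact Set.subset_iUnion (fun a => psi c a '' Vstar c) a

theorem IsSelfSimilar.subset {c : ℝ} (hc : c ∈ Set.Ioo (0 : ℝ) (1 / 2)) {K L : Set Plane}
    (hK : IsSelfSimilar c K) (hL : IsSelfSimilar c L) : K ⊆ L := by
  obtain ⟨x, hxK, hx⟩ := hK.isCompact.exists_isMaxOn hK.nonempty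
    (Metric.continuous_infDist_pt L).continuousOn
  have hx0 : Metric.infDist x L ≤ 0 := by
    have hx' := hxK
    rw [hK.eq_iUnion] at hx'
    obtain ⟨a, y, hyK, rfl⟩ : ∃ a, ∃ y ∈ K, psi c a y = x := by simpa using hx'
    obtain ⟨z, hzL, hz⟩ := hL.isCompact.exists_infDist_eq_dist hL.nonempty y
    have hmem : psi c a z ∈ L := by
      rw [hL.eq_iUnion]
      exact Set.mem_iUnion.2 ⟨a, z, hzL, rfl⟩
    have h1 := Metric.infDist_le_dist_of_mem (x := psi c a y) hmem
    have h2 := dist_psi_le hc a y z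
    have h3 : Metric.infDist y L ≤ Metric.infDist (psi c a y) L := hx hyK
    linarith
  intro y hy
  have h1 : Metric.infDist y L ≤ Metric.infDist x L := hx hy
  rw [hL.isCompact.isClosed.mem_iff_infDist_zero hL.nonempty]
  exact le_antisymm (h1.trans hx0) Metric.infDist_nonneg

theorem existsUnique_isSelfSimilar {c : ℝ} (hc : c ∈ Set.Ioo (0 : ℝ) (1 / 2)) :
    ∃! K : Set Plane, IsSelfSimilar c K :=
  ⟨_, isSelfSimilar_closure_Vstar hc, fun _ hK =>
    (hK.subset hc (isSelfSimilar_closure_Vstar hc)).antisymm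
      ((isSelfSimilar_closure_Vstar hc).subset hc hK)⟩

theorem T_eq_closure {c : ℝ} (hc : c ∈ Set.Ioo (0 : ℝ) (1 / 2)) : T c = closure (Vstar c) :=
  Set.Subset.antisymm
    (Set.sUnion_subset fun _ hK => IsSelfSimilar.subset hc hK (isSelfSimilar_closure_Vstar hc))
    (Set.subset_sUnion_of_mem (isSelfSimilar_closure_Vstar hc))

theorem isSelfSimilar_T {c : ℝ} (hc : c ∈ Set.Ioo (0 : ℝ) (1 / 2)) : IsSelfSimilar c (T c) :=
  T_eq_closure hc ▸ isSelfSimilar_closure_Vstar hc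

theorem Vstar_subset_T {c : ℝ} (hc : c ∈ Set.Ioo (0 : ℝ) (1 / 2)) : Vstar c ⊆ T c :=
  T_eq_closure hc ▸ subset_closure

/-- A topological dendrite: an arc-wise connected space containing no subset homeomorphic to
the circle. -/
structure IsDendrite (X : Type*) [TopologicalSpace X] : Prop where
  exists_arc : ∀ x y : X, x ≠ y →
    ∃ γ : unitInterval → X, IsEmbedding γ ∧ γ 0 = x ∧ γ 1 = y
  no_circle : ∀ s : Set X, IsEmpty (s ≃ₜ Circle)

/-- The topology induced by a metric. -/
abbrev metricTopology {X : Type*} (d : MetricSpace X) : TopologicalSpace X :=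
  d.toPseudoMetricSpace.toUniformSpace.toTopologicalSpace

/-- `(Y, dY)` is the completion of `(X, dX)` through the embedding `ι`. -/
def IsCompletion {X Y : Type*} (dX : MetricSpace X) (dY : MetricSpace Y) (ι : X → Y) : Prop :=
  CompleteSpace Y ∧ Isometry ι ∧ DenseRange ι

/-- The vector `(w(ij))_{j ∈ S}` attached to the finite word `i`. -/
def offspring {Ω : Type*} (w : Word → Ω → ℝ) (i : Word) (ω : Ω) : Fin 3 → ℝ :=
  fun j => w (i ++ [j]) ω

/-- A multiplicative cascade: random variables `w(i)`, for `i` a non-empty finite word, with values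
in `[0,1]`, such that the vectors `(w(ij))_{j ∈ S}`, for `i` a finite word (possibly empty), are
independent and all have the law of `(w(j))_{j ∈ S}`. The value of `w` at the empty word is
irrelevant. -/
structure IsMultiplicativeCascade {Ω : Type*} [MeasurableSpace Ω] (P : Measure Ω)
    (w : Word → Ω → ℝ) : Prop where
  measurable : ∀ i : Word, i ≠ [] → Measurable (w i)
  mem_Icc : ∀ i : Word, i ≠ [] → ∀ ω : Ω, w i ω ∈ Set.Icc (0 : ℝ) 1
  iIndepFun : iIndepFun (offspring w) P
  identDistrib : ∀ i : Word, IdentDistrib (offspring w i) (offspring w []) P P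

/-! In what follows `u : Word → ℝ` is a realisation of the cascade. -/

/-- `l(i) = w(i|1) w(i|2) ⋯ w(i)`, with `l(∅) = 1`. -/
def l (u : Word → ℝ) (i : Word) : ℝ :=
  ∏ m ∈ Finset.range i.length, u (i.take (m + 1))

/-- `∑_{j ∈ {1,2}ⁿ} l(ij) / l(i)`. -/
def resistanceSum (u : Word → ℝ) (i : Word) (n : ℕ) : ℝ :=
  ∑ j : Fin n → Fin 2, l u (i ++ List.ofFn fun k => (j k).castSucc) / l u i

/-- The resistance perturbation `R_i = lim_n ∑_{j ∈ {1,2}ⁿ} l(ij) / l(i)`. -/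
def resistancePert (u : Word → ℝ) (i : Word) : ℝ :=
  limUnder atTop (resistanceSum u i)

/-- The point `ψ_i(0,0)` or `ψ_i(1,0)` as an element of `V*`. -/
def vertex (c : ℝ) (i : Word) (b : Fin 2) : Vstar c :=
  ⟨psiWord c i (corner b), mem_Vstar_iff.2 ⟨i, b, rfl⟩⟩

/-- The quadratic form `ℰⁿ(f,f) = ∑_{|i| = n} (l(i) R_i)⁻¹ (f(ψ_i(0,0)) - f(ψ_i(1,0)))²`. -/
def energy (c : ℝ) (u : Word → ℝ) (n : ℕ) (f : Vstar c → ℝ) : ℝ :=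
  ∑ i : Fin n → Fin 3,
    1 / (l u (List.ofFn i) * resistancePert u (List.ofFn i)) *
      (f (vertex c (List.ofFn i) 0) - f (vertex c (List.ofFn i) 1)) ^ 2

/-- `ℱ*`: the functions on `V*` for which `lim_n ℰⁿ(f,f)` exists finitely. -/
def energyDomain (c : ℝ) (u : Word → ℝ) : Set (Vstar c → ℝ) :=
  {f | ∃ e : ℝ, Tendsto (fun n => energy c u n f) atTop (𝓝 e)}

/-- `ℰ*(f,f) = lim_n ℰⁿ(f,f)`, meaningful for `f ∈ ℱ*`. -/
def limitEnergy (c : ℝ) (u : Word → ℝ) (f : Vstar c → ℝ) : ℝ :=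
  limUnder atTop fun n => energy c u n f

open Classical in
/-- The resistance `R*` on `V*`: `R*(x,x) = 0`, and for `x ≠ y`
`R*(x,y)⁻¹ = inf {ℰ*(f,f) : f ∈ ℱ*, f(x) = 0, f(y) = 1}`. -/
def Rstar (c : ℝ) (u : Word → ℝ) (x y : Vstar c) : ℝ :=
  if x = y then 0
  else (sInf {e : ℝ | ∃ f ∈ energyDomain c u, f x = 0 ∧ f y = 1 ∧ limitEnergy c u f = e})⁻¹

end RandomDendrite

end

/-!
The set `T` is the union of three half-scale copies of itself (its cells) that meet only at the
common image of the corner `(0,0)`; a rhombus that contains its images under the three contractions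
shows this (`eq_corner_of_psi_eq`). Such a gluing is recorded as a `StarIFS`. The retractions of `T`
onto its cells, iterated along words, carry the whole tree structure.

*The metric.* Suppose that the numbers `L i = l(i) R_i` are positive, satisfy
`L i = L (i1) + L (i2)`, and are at most `C θ ^ |i|` with `θ < 1` (`EdgeLengths`). The sum over the
cells `i` of level `n` of `L i` times a fixed distance between the retractions of `x` and `y` to the
cell `i` is a continuous pseudometric. Only the at most two cells containing `x` or `y` in their
interior contribute to the difference of consecutive levels, so these pseudometrics converge
uniformly, and the limit `resDist` is continuous. It is a metric because different points are
separated by some cell (`StarIFS.exists_sep`), and it satisfies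
`R_L(x, y) = ∑ a, R_{L_a}(retr a x, retr a y)`. By compactness it induces the Euclidean topology.

*The resistance.* By the Cauchy–Schwarz inequality and induction on the level,
`(f x - f y)² ≤ R(x, y) ℰⁿ(f, f)` as soon as `x` and `y` are vertices of level `n`, and the function
`R(x, ·) - R(y, ·)`, suitably normalised, gives equality. Hence `Rstar` is the restriction of
`resDist` to `V*` (`Rstar_eq_resDist`), and all assertions about `R` follow, except that `T` is a
dendrite.

*The dendrite.* A circle stays connected when a point is removed, so a circle in `T` would lie in a
single cell of each level (`StarIFS.exists_subset_cell`), although the cells shrink to points. An arc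
from `x` to `y` is a geodesic of `resDist`: there is at least one point at each distance from `x` on
the segment between them by Menger's argument (`StarIFS.exists_between`), since any two points have
the centre of a separating cell strictly between them, and at most one, by descent to the cell where
two candidates part (`StarIFS.between_unique`).

*The probability.* On the canonical space the realisations seen from the three letters are
independent copies of the whole, independent of the weights at the root
(`measurePreserving_branching`). The sums `mart n` defining `R_∅` have orthogonal increments whose
second moments decay geometrically, so they converge. Their exponential moments near the origin are
bounded uniformly in `n` (`integral_exp_mart_le`). The limit is zero if and only if the two limits
one level below are zero, which has probability `0` or `1`, and the exponential moments exclude `1`.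
Finally, since the weights are equal to `1` with total probability less than `1`, there is a `p` for
which the `p`-th powers of the weights have expected sum less than `1`; as `R_∅` has moments of all
orders, the `p`-th powers of the edge lengths of level `m` have geometrically decaying expected sum,
which gives the bound `C θ ^ |i|` (`ae_exists_ell_mul_le`).
-/

noncomputable section

namespace RandomDendrite

/-! ### Self-similar spaces glued from three cells at one point -/

/-- A metric space `X` that is the union of three half-scale copies ("cells") of itself, any two
of which meet exactly at the common image of the boundary point `c0`. The boundary points `c0`,
`c1` of `X` are the images of `c1` in the cells `0`, `1`. -/
structure StarIFS (X : Type*) [MetricSpace X] where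
  /-- The embedding of `X` onto the cell `a`. -/
  toFun : Fin 3 → X → X
  /-- The boundary point that all the cells place at their common point. -/
  c0 : X
  /-- The other boundary point. -/
  c1 : X
  ne : c0 ≠ c1
  dist_le : ∀ a x y, dist (toFun a x) (toFun a y) ≤ 1 / 2 * dist x y
  inj : ∀ a, Function.Injective (toFun a)
  cover : ∀ x, ∃ a y, toFun a y = x
  glue : ∀ a b, toFun a c0 = toFun b c0
  inter : ∀ a b x y, a ≠ b → toFun a x = toFun b y → x = c0
  zero_c1 : toFun 0 c1 = c0
  one_c1 : toFun 1 c1 = c1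

namespace StarIFS

variable {X : Type*} [MetricSpace X] (S : StarIFS X)

open Classical in
/-- The retraction of `X` onto the cell `a`, read in the coordinates of that cell: it inverts
`S.toFun a`, and it sends the other cells to `c0`. -/
def retr (a : Fin 3) (x : X) : X := if h : ∃ y, S.toFun a y = x then h.choose else S.c0

@[simp] theorem retr_self (a : Fin 3) (x : X) : S.retr a (S.toFun a x) = x := by
  have h : ∃ y, S.toFun a y = S.toFun a x := ⟨x, rfl⟩
  rw [retr, dif_pos h]
  exact S.inj a h.choose_spec

theorem retr_of_ne {a b : Fin 3} (hab : a ≠ b) (x : X) : S.retr a (S.toFun b x) = S.c0 := by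
  rw [retr]
  split_ifs with h
  · exact S.inter a b _ _ hab h.choose_spec
  · rfl

theorem retr_zero_c0 : S.retr 0 S.c0 = S.c1 := by
  conv_lhs => rw [← S.zero_c1]
  exact S.retr_self 0 S.c1

theorem retr_c0_of_ne {a : Fin 3} (ha : a ≠ 0) : S.retr a S.c0 = S.c0 := by
  conv_lhs => rw [← S.zero_c1]
  exact S.retr_of_ne ha _

theorem retr_one_c1 : S.retr 1 S.c1 = S.c1 := by
  conv_lhs => rw [← S.one_c1]
  exact S.retr_self 1 S.c1

theorem retr_c1_of_ne {a : Fin 3} (ha : a ≠ 1) : S.retr a S.c1 = S.c0 := by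
  conv_lhs => rw [← S.one_c1]
  exact S.retr_of_ne ha _

theorem continuous_toFun (a : Fin 3) : Continuous (S.toFun a) :=
  (LipschitzWith.of_dist_le_mul (K := 1 / 2) fun x y => by simpa using S.dist_le a x y).continuous

theorem continuous_retr [CompactSpace X] (a : Fin 3) : Continuous (S.retr a) := by
  have himg : ∀ (b : Fin 3) (C : Set X), IsClosed C → IsClosed (S.toFun b '' C) := fun b C hC =>
    (hC.isCompact.image (S.continuous_toFun b)).isClosed
  refine continuous_iff_isClosed.2 fun C hC => ?_
  by_cases h0 : S.c0 ∈ C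
  · have : S.retr a ⁻¹' C = S.toFun a '' C ∪ ⋃ b : {b : Fin 3 // b ≠ a}, S.toFun b '' Set.univ := by
      ext x
      obtain ⟨b, y, rfl⟩ := S.cover x
      constructor
      · intro hx
        by_cases hb : b = a
        · subst hb
          exact Or.inl ⟨y, by simpa using hx, rfl⟩
        · exact Or.inr (Set.mem_iUnion.2 ⟨⟨b, hb⟩, y, trivial, rfl⟩)
      · rintro (⟨z, hz, h⟩ | h)
        · rw [← h]
          simpa using hz
        · obtain ⟨⟨d, hd⟩, z, -, h⟩ := Set.mem_iUnion.1 h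
          rw [← h, Set.mem_preimage]
          change S.retr a (S.toFun d z) ∈ C
          rwa [S.retr_of_ne (Ne.symm hd)]
    rw [this]
    exact (himg a C hC).union (isClosed_iUnion_of_finite fun b => himg b _ isClosed_univ)
  · have : S.retr a ⁻¹' C = S.toFun a '' C := by
      ext x
      obtain ⟨b, y, rfl⟩ := S.cover x
      constructor
      · intro hx
        by_cases hb : b = a
        · subst hb
          exact ⟨y, by simpa using hx, rfl⟩
        · rw [Set.mem_preimage, S.retr_of_ne (Ne.symm hb)] at hx
          exact (h0 hx).elim
      · rintro ⟨z, hz, h⟩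
        rw [← h]
        simpa using hz
    rw [this]
    exact himg a C hC

/-- The embedding of `X` onto the cell of the word `i`. -/
def wordMap : Word → X → X
  | [], x => x
  | a :: i, x => S.toFun a (wordMap i x)

/-- The retraction onto the cell of the word `i`, in the coordinates of that cell. -/
def wordRetr : Word → X → X
  | [], x => x
  | a :: i, x => wordRetr i (S.retr a x)

theorem wordRetr_wordMap (i : Word) (x : X) : S.wordRetr i (S.wordMap i x) = x := by
  induction i with
  | nil => rfl
  | cons a i ih => simp only [wordMap, wordRetr, retr_self, ih]

/-- The vertices of level `n`: `c0` and `c1` at level `0`, and the images of the vertices of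
level `n` in the three cells at level `n + 1`. -/
def vert : ℕ → Set X
  | 0 => {S.c0, S.c1}
  | n + 1 => ⋃ a, S.toFun a '' vert n

theorem toFun_mem_vert {n : ℕ} {x : X} (a : Fin 3) (hx : x ∈ S.vert n) :
    S.toFun a x ∈ S.vert (n + 1) := Set.mem_iUnion.2 ⟨a, x, hx, rfl⟩

theorem c1_mem_vert (n : ℕ) : S.c1 ∈ S.vert n := by
  induction n with
  | zero => exact Or.inr rfl
  | succ n ih =>
    have := S.toFun_mem_vert 1 ih
    rwa [S.one_c1] at this

theorem c0_mem_vert (n : ℕ) : S.c0 ∈ S.vert n := by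
  cases n with
  | zero => exact Or.inl rfl
  | succ n =>
    have := S.toFun_mem_vert 0 (S.c1_mem_vert n)
    rwa [S.zero_c1] at this

theorem vert_subset_succ (n : ℕ) : S.vert n ⊆ S.vert (n + 1) := by
  induction n with
  | zero =>
    rintro x (rfl | rfl)
    exacts [S.c0_mem_vert _, S.c1_mem_vert _]
  | succ n ih =>
    intro x hx
    obtain ⟨a, y, hy, rfl⟩ := Set.mem_iUnion.1 hx
    exact S.toFun_mem_vert a (ih hy)

theorem vert_mono : Monotone S.vert := monotone_nat_of_le_succ S.vert_subset_succ

theorem wordMap_mem_vert (i : Word) {x : X} (hx : x ∈ S.vert 0) :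
    S.wordMap i x ∈ S.vert i.length := by
  induction i with
  | nil => exact hx
  | cons a i ih => exact S.toFun_mem_vert a ih

theorem retr_mem_vert {n : ℕ} {x : X} (a : Fin 3) (hx : x ∈ S.vert (n + 1)) :
    S.retr a x ∈ S.vert n := by
  obtain ⟨b, y, hy, rfl⟩ := Set.mem_iUnion.1 hx
  by_cases hab : a = b
  · subst hab
    simpa using hy
  · rw [S.retr_of_ne hab]
    exact S.c0_mem_vert n

/-- The difference of a function at two points is the sum of its differences across the cells:
a path from `x` to `y` crosses each cell at most once, between the retractions of `x` and `y`. -/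
theorem sub_eq_sum_retr (f : X → ℝ) (x y : X) :
    f x - f y = ∑ a, (f (S.toFun a (S.retr a x)) - f (S.toFun a (S.retr a y))) := by
  have key : ∀ z, ∑ a, f (S.toFun a (S.retr a z)) = f z + 2 * f (S.toFun 0 S.c0) := by
    intro z
    obtain ⟨b, w, rfl⟩ := S.cover z
    have h : ∀ a, f (S.toFun a (S.retr a (S.toFun b w))) =
        if a = b then f (S.toFun b w) else f (S.toFun 0 S.c0) := by
      intro a
      split_ifs with hab
      · subst hab
        rw [retr_self]
      · rw [S.retr_of_ne hab, S.glue a 0]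
    simp only [h, Fin.sum_univ_three]
    fin_cases b <;> simp <;> ring
  rw [Finset.sum_sub_distrib, key, key]
  ring

theorem exists_dist_le [CompactSpace X] : ∃ D, ∀ x y : X, dist x y ≤ D := by
  obtain ⟨D, hD⟩ := Metric.isBounded_iff.1 (isCompact_univ (X := X)).isBounded
  exact ⟨D, fun x y => hD trivial trivial⟩

/-- A relation that descends to the cells or else forces equality forces equality. -/
theorem eq_of_descent [CompactSpace X] {α : Type*} (Q : α → X → X → Prop)
    (h : ∀ l x y, Q l x y → x = y ∨ ∃ a x' y' l', S.toFun a x' = x ∧ S.toFun a y' = y ∧ Q l' x' y')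
    {l : α} {x y : X} (hxy : Q l x y) : x = y := by
  obtain ⟨D, hD⟩ := exists_dist_le (X := X)
  have key : ∀ n : ℕ, ∀ l x y, Q l x y → dist x y ≤ (1 / 2) ^ n * D := by
    intro n
    induction n with
    | zero => intro l x y _; simpa using hD x y
    | succ n ih =>
      intro l x y hQ
      rcases h l x y hQ with rfl | ⟨a, x', y', l', rfl, rfl, hQ'⟩
      · have := (dist_nonneg (x := x) (y := x)).trans (hD x x)
        simpa using by positivity
      · have h1 := S.dist_le a x' y'
        have h2 := ih l' x' y' hQ'
        rw [pow_succ]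
        linarith
  have hlim : Tendsto (fun n : ℕ => (1 / 2 : ℝ) ^ n * D) atTop (𝓝 (0 * D)) :=
    (tendsto_pow_atTop_nhds_zero_of_lt_one (by norm_num) (by norm_num)).mul_const D
  rw [zero_mul] at hlim
  exact dist_le_zero.1 (ge_of_tendsto' hlim fun n => key n l x y hxy)

/-- The word `i` separates `x` and `y` if the retraction onto the cell of `i` takes these points
to the two different boundary points. -/
def Sep (i : Word) (x y : X) : Prop :=
  (S.wordRetr i x = S.c0 ∧ S.wordRetr i y = S.c1) ∨
    (S.wordRetr i x = S.c1 ∧ S.wordRetr i y = S.c0)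

variable {S}

theorem Sep.symm {i : Word} {x y : X} (h : S.Sep i x y) : S.Sep i y x :=
  h.elim (fun h => Or.inr h.symm) fun h => Or.inl h.symm

theorem exists_sep_of_retr (a : Fin 3) {x y : X} (h : ∃ i, S.Sep i (S.retr a x) (S.retr a y)) :
    ∃ i, S.Sep i x y :=
  h.elim fun i hi => ⟨a :: i, hi⟩

variable (S)

theorem exists_sep_c1 [CompactSpace X] {x : X} (hx : x ≠ S.c1) : ∃ i, S.Sep i x S.c1 := by
  by_contra hsep
  refine hx (S.eq_of_descent (fun (_ : Unit) x y => y = S.c1 ∧ ¬ ∃ i, S.Sep i x S.c1) ?_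
    (l := ()) ⟨rfl, hsep⟩)
  rintro - x y ⟨rfl, h⟩
  obtain ⟨a, z, rfl⟩ := S.cover x
  by_cases ha : a = 1
  · subst ha
    refine Or.inr ⟨1, z, S.c1, (), rfl, S.one_c1, rfl, fun h' => h (exists_sep_of_retr 1 ?_)⟩
    rwa [retr_self, retr_one_c1]
  · refine (h (exists_sep_of_retr 1 ⟨[], Or.inl ⟨?_, ?_⟩⟩)).elim
    exacts [S.retr_of_ne (Ne.symm ha) z, S.retr_one_c1]

theorem exists_sep_c0 [CompactSpace X] {x : X} (hx : x ≠ S.c0) : ∃ i, S.Sep i x S.c0 := by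
  obtain ⟨a, z, rfl⟩ := S.cover x
  apply exists_sep_of_retr 0
  rw [retr_zero_c0]
  by_cases ha : a = 0
  · subst ha
    rw [retr_self]
    refine S.exists_sep_c1 ?_
    rintro rfl
    exact hx S.zero_c1
  · rw [S.retr_of_ne (Ne.symm ha)]
    exact ⟨[], Or.inl ⟨rfl, rfl⟩⟩

/-- Two different points are separated by some cell. -/
theorem exists_sep [CompactSpace X] {x y : X} (hxy : x ≠ y) : ∃ i, S.Sep i x y := by
  by_contra hsep
  refine hxy (S.eq_of_descent (fun (_ : Unit) x y => ¬ ∃ i, S.Sep i x y) ?_ (l := ()) hsep)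
  intro _ x y h
  obtain ⟨a, x, rfl⟩ := S.cover x
  obtain ⟨b, y, rfl⟩ := S.cover y
  by_cases hab : a = b
  · subst hab
    refine Or.inr ⟨a, x, y, (), rfl, rfl, fun h' => h (exists_sep_of_retr a ?_)⟩
    rwa [retr_self, retr_self]
  · have hx : x = S.c0 := by
      by_contra hx
      apply h (exists_sep_of_retr a _)
      rw [retr_self, S.retr_of_ne hab]
      exact S.exists_sep_c0 hx
    have hy : y = S.c0 := by
      by_contra hy
      apply h (exists_sep_of_retr b _)
      rw [retr_self, S.retr_of_ne (Ne.symm hab)]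
      obtain ⟨i, hi⟩ := S.exists_sep_c0 hy
      exact ⟨i, hi.symm⟩
    rw [hx, hy]
    exact Or.inl (S.glue a b)

/-- A connected set that stays connected when any point is removed lies in one cell: the common
point of the cells would disconnect it. -/
theorem exists_subset_cell [CompactSpace X] {C : Set X}
    (hC : ∀ p, IsPreconnected (C \ {p})) : ∃ a, C ⊆ Set.range (S.toFun a) := by
  set m := S.toFun 0 S.c0 with hm
  have hcl : ∀ b, IsClosed (Set.range (S.toFun b)) := fun b => by
    rw [← Set.image_univ]
    exact (isCompact_univ.image (S.continuous_toFun b)).isClosed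
  have hmr : ∀ a, m ∈ Set.range (S.toFun a) := fun a => ⟨S.c0, S.glue a 0⟩
  by_cases hne : (C \ {m}).Nonempty
  · obtain ⟨x, hxC, hxm⟩ := hne
    obtain ⟨a, z, rfl⟩ := S.cover x
    refine ⟨a, fun y hyC => ?_⟩
    by_contra hy
    have hym : y ≠ m := fun h => hy (h ▸ hmr a)
    obtain ⟨b, v, rfl⟩ := S.cover y
    have hba : b ≠ a := by
      rintro rfl
      exact hy ⟨v, rfl⟩
    have := isPreconnected_closed_iff.1 (hC m) (Set.range (S.toFun a))
      (⋃ d : {d : Fin 3 // d ≠ a}, Set.range (S.toFun d)) (hcl a)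
      (isClosed_iUnion_of_finite fun d => hcl d) ?_ ⟨_, ⟨hxC, hxm⟩, z, rfl⟩
      ⟨_, ⟨hyC, hym⟩, Set.mem_iUnion.2 ⟨⟨b, hba⟩, v, rfl⟩⟩
    · obtain ⟨p, ⟨-, hpm⟩, ⟨q, rfl⟩, hp⟩ := this
      obtain ⟨⟨d, hd⟩, r, hr⟩ := Set.mem_iUnion.1 hp
      have : q = S.c0 := S.inter a d q r (Ne.symm hd) hr.symm
      exact hpm (by rw [this, hm]; exact S.glue a 0)
    · rintro p -
      obtain ⟨d, q, rfl⟩ := S.cover p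
      by_cases hd : d = a
      · subst hd
        exact Or.inl ⟨q, rfl⟩
      · exact Or.inr (Set.mem_iUnion.2 ⟨⟨d, hd⟩, q, rfl⟩)
  · refine ⟨0, fun y hyC => ?_⟩
    by_contra hy
    exact hne ⟨y, hyC, fun h => hy (h ▸ hmr 0)⟩

/-- The cells of all levels containing `C`, found by iterating `exists_subset_cell`, shrink to a
point. -/
theorem subsingleton_of_isPreconnected_diff {Y : Type*} [MetricSpace Y] [CompactSpace Y]
    (S : StarIFS Y) {C : Set Y} (hC : ∀ p, IsPreconnected (C \ {p})) : C.Subsingleton := by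
  intro x hx y hy
  refine S.eq_of_descent (fun (C : {C : Set Y // ∀ p, IsPreconnected (C \ {p})}) x y =>
    x ∈ C.1 ∧ y ∈ C.1) ?_ (l := ⟨C, hC⟩) ⟨hx, hy⟩
  rintro ⟨C, hC⟩ x y ⟨hx, hy⟩
  obtain ⟨a, ha⟩ := S.exists_subset_cell hC
  obtain ⟨x', rfl⟩ := ha hx
  obtain ⟨y', rfl⟩ := ha hy
  refine Or.inr ⟨a, x', y', ⟨S.toFun a ⁻¹' C, fun p => ?_⟩, rfl, rfl, hx, hy⟩
  have : S.toFun a ⁻¹' C \ {p} = S.retr a '' (C \ {S.toFun a p}) := by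
    ext q
    constructor
    · rintro ⟨hq, hqp⟩
      exact ⟨S.toFun a q, ⟨hq, fun h => hqp (S.inj a h)⟩, S.retr_self a q⟩
    · rintro ⟨r, ⟨hr, hrp⟩, rfl⟩
      obtain ⟨q, rfl⟩ := ha hr
      rw [retr_self]
      refine ⟨hr, ?_⟩
      rintro rfl
      exact hrp rfl
  rw [this]
  exact (hC _).image _ (S.continuous_retr a).continuousOn

end StarIFS

/-- Removing a point from the circle leaves a connected set. -/
theorem isPreconnected_circle_compl_singleton (z : Circle) :
    IsPreconnected ({z}ᶜ : Set Circle) := by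
  obtain ⟨s, rfl⟩ := Circle.exp_surjective z
  have : ({Circle.exp s}ᶜ : Set Circle) = Circle.exp '' Set.Ioo s (s + 2 * Real.pi) := by
    ext w
    simp only [Set.mem_compl_iff, Set.mem_singleton_iff, Set.mem_image]
    constructor
    · intro hw
      obtain ⟨t, rfl⟩ := Circle.exp_surjective w
      obtain ⟨t', ht', h⟩ := Circle.periodic_exp.exists_mem_Ico Real.two_pi_pos t s
      refine ⟨t', ⟨lt_of_le_of_ne ht'.1 ?_, ht'.2⟩, h.symm⟩
      rintro rfl
      exact hw h
    · rintro ⟨t, ht, rfl⟩ h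
      obtain ⟨k, hk⟩ := Circle.exp_eq_exp.1 h
      have h1 : (0 : ℝ) < k := by
        by_contra! h0
        nlinarith [ht.1, Real.two_pi_pos]
      have h2 : (k : ℝ) < 1 := by
        by_contra! h0
        nlinarith [ht.2, Real.two_pi_pos]
      have h1' : (0 : ℤ) < k := by exact_mod_cast h1
      have h2' : k < (1 : ℤ) := by exact_mod_cast h2
      omega
  rw [this]
  exact isPreconnected_Ioo.image _ Circle.exp.continuous.continuousOn

theorem StarIFS.isEmpty_homeomorph_circle {X : Type*} [MetricSpace X] [CompactSpace X]
    (S : StarIFS X) (C : Set X) : IsEmpty (C ≃ₜ Circle) := by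
  refine ⟨fun e => ?_⟩
  have hsub : C.Subsingleton := by
    refine S.subsingleton_of_isPreconnected_diff fun p => ?_
    have hcirc : IsPreconnected {z : Circle | ((e.symm z : C) : X) ≠ p} := by
      by_cases hp : p ∈ C
      · have : {z : Circle | ((e.symm z : C) : X) ≠ p} = {e ⟨p, hp⟩}ᶜ := by
          ext z
          simp only [Set.mem_ofPred_eq, Set.mem_compl_iff, Set.mem_singleton_iff, ne_eq, not_iff_not]
          rw [← e.symm_apply_eq.trans Iff.rfl, Subtype.ext_iff]
        rw [this]
        exact isPreconnected_circle_compl_singleton _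
      · have : {z : Circle | ((e.symm z : C) : X) ≠ p} = Set.univ := by
          refine Set.eq_univ_of_forall fun z hz => hp ?_
          rw [← hz]
          exact (e.symm z).2
        rw [this]
        have := isPreconnected_univ.image Circle.exp Circle.exp.continuous.continuousOn
        rwa [Set.image_univ, Circle.exp_surjective.range_eq] at this
    have : C \ {p} = (fun z => ((e.symm z : C) : X)) '' {z : Circle | ((e.symm z : C) : X) ≠ p} := by
      ext x
      constructor
      · rintro ⟨hx, hxp⟩
        exact ⟨e ⟨x, hx⟩, by simpa using hxp, by simp⟩
      · rintro ⟨z, hz, rfl⟩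
        exact ⟨(e.symm z).2, hz⟩
    rw [this]
    exact hcirc.image _ (continuous_subtype_val.comp e.symm.continuous).continuousOn
  have : Circle.exp 0 = Circle.exp Real.pi := by
    apply e.symm.injective
    exact Subtype.ext (hsub (e.symm _).2 (e.symm _).2)
  simp at this
  have h2 := congrArg Subtype.val this
  norm_num [Circle.ext_iff] at this

/-! ### Edge lengths and the resistance metric -/

/-- The edge lengths seen from inside the cell `a`. -/
def subtreeLength (L : Word → ℝ) (a : Fin 3) : Word → ℝ := fun i => L (a :: i)

/-- A consistent system of edge lengths: positive, additive along the subdivision of an edge into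
its first two subcells, and geometrically small in the level. -/
structure EdgeLengths (L : Word → ℝ) : Prop where
  pos : ∀ i, 0 < L i
  split : ∀ i, L i = L (i ++ [0]) + L (i ++ [1])
  decay : ∃ C θ : ℝ, 0 ≤ θ ∧ θ < 1 ∧ ∀ i, L i ≤ C * θ ^ i.length

theorem EdgeLengths.subtree {L : Word → ℝ} (hL : EdgeLengths L) (a : Fin 3) :
    EdgeLengths (subtreeLength L a) where
  pos i := hL.pos _
  split i := hL.split (a :: i)
  decay := by
    obtain ⟨C, θ, h0, h1, h⟩ := hL.decay
    refine ⟨C * θ, θ, h0, h1, fun i => (h (a :: i)).trans (le_of_eq ?_)⟩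
    rw [List.length_cons, pow_succ]
    ring

namespace StarIFS

variable {X : Type*} [MetricSpace X] (S : StarIFS X)

/-- A continuous function `X → [0,1]` with value `0` at `c0` and `1` at `c1`. -/
def chi (x : X) : ℝ := min 1 (dist x S.c0 / dist S.c1 S.c0)

theorem chi_c0 : S.chi S.c0 = 0 := by simp [chi]

theorem chi_c1 : S.chi S.c1 = 1 := by
  rw [chi, div_self (dist_ne_zero.2 S.ne.symm), min_self]

theorem abs_chi_sub_le (x y : X) : |S.chi x - S.chi y| ≤ 1 := by
  have h : ∀ z, 0 ≤ S.chi z ∧ S.chi z ≤ 1 := fun z =>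
    ⟨le_min zero_le_one (by positivity), min_le_left _ _⟩
  rw [abs_le]
  constructor <;> linarith [h x, h y]

theorem continuous_chi : Continuous S.chi := by
  unfold chi
  fun_prop

/-- The level-`n` approximation of the resistance metric: the sum over the cells `w` of level `n`
of `L w`, weighted by the distance between the retractions of the two points onto this cell as
measured by `chi`. -/
def preDist : ℕ → (Word → ℝ) → X → X → ℝ
  | 0, L, x, y => L [] * |S.chi x - S.chi y|
  | n + 1, L, x, y => ∑ a, preDist n (subtreeLength L a) (S.retr a x) (S.retr a y)

theorem preDist_self (n : ℕ) (L : Word → ℝ) (x : X) : S.preDist n L x x = 0 := by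
  induction n generalizing L x with
  | zero => simp [preDist]
  | succ n ih => simp [preDist, ih]

theorem preDist_comm (n : ℕ) (L : Word → ℝ) (x y : X) :
    S.preDist n L x y = S.preDist n L y x := by
  induction n generalizing L x y with
  | zero => simp only [preDist, abs_sub_comm]
  | succ n ih => exact Finset.sum_congr rfl fun a _ => ih _ _ _

theorem preDist_nonneg (n : ℕ) {L : Word → ℝ} (hL : EdgeLengths L) (x y : X) :
    0 ≤ S.preDist n L x y := by
  induction n generalizing L x y with
  | zero => exact mul_nonneg (hL.pos _).le (abs_nonneg _)
  | succ n ih => exact Finset.sum_nonneg fun a _ => ih (hL.subtree a) _ _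

theorem preDist_triangle (n : ℕ) {L : Word → ℝ} (hL : EdgeLengths L) (x y z : X) :
    S.preDist n L x z ≤ S.preDist n L x y + S.preDist n L y z := by
  induction n generalizing L x y z with
  | zero =>
    simp only [preDist, ← mul_add]
    exact mul_le_mul_of_nonneg_left (abs_sub_le _ _ _) (hL.pos _).le
  | succ n ih =>
    simp only [preDist, ← Finset.sum_add_distrib]
    exact Finset.sum_le_sum fun a _ => ih (hL.subtree a) _ _ _

theorem continuous_preDist [CompactSpace X] (n : ℕ) (L : Word → ℝ) :
    Continuous fun p : X × X => S.preDist n L p.1 p.2 := by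
  induction n generalizing L with
  | zero =>
    have := S.continuous_chi
    simp only [preDist]
    fun_prop
  | succ n ih =>
    refine continuous_finsetSum _ fun a _ => ?_
    exact (ih (subtreeLength L a)).comp ((S.continuous_retr a).prodMap (S.continuous_retr a))

theorem retr_boundary {x : X} (hx : x ∈ S.vert 0) (a : Fin 3) : S.retr a x ∈ S.vert 0 :=
  S.retr_mem_vert a (S.vert_subset_succ 0 hx)

theorem preDist_zero_c0_c1 (L : Word → ℝ) : S.preDist 0 L S.c0 S.c1 = L [] := by
  simp [preDist, chi_c0, chi_c1]

/-- On boundary points all approximations agree, by additivity of the edge lengths. -/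
theorem preDist_boundary (n : ℕ) {L : Word → ℝ} (hL : EdgeLengths L) {x y : X}
    (hx : x ∈ S.vert 0) (hy : y ∈ S.vert 0) : S.preDist n L x y = S.preDist 0 L x y := by
  induction n generalizing L x y with
  | zero => rfl
  | succ n ih =>
    have h : S.preDist (n + 1) L x y =
        ∑ a, S.preDist 0 (subtreeLength L a) (S.retr a x) (S.retr a y) :=
      Finset.sum_congr rfl fun a _ =>
        ih (hL.subtree a) (S.retr_boundary hx a) (S.retr_boundary hy a)
    have h2 := hL.split []
    have e00 := S.retr_zero_c0
    have e01 := S.retr_c0_of_ne (show (1 : Fin 3) ≠ 0 by decide)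
    have e02 := S.retr_c0_of_ne (show (2 : Fin 3) ≠ 0 by decide)
    have e10 := S.retr_c1_of_ne (show (0 : Fin 3) ≠ 1 by decide)
    have e11 := S.retr_one_c1
    have e12 := S.retr_c1_of_ne (show (2 : Fin 3) ≠ 1 by decide)
    rw [h, Fin.sum_univ_three]
    rcases hx with rfl | rfl <;> rcases hy with rfl | rfl <;>
      simp [preDist, e00, e01, e02, e10, e11, e12, chi_c0, chi_c1, subtreeLength] <;>
      simpa using h2.symm

theorem preDist_eq_of_le {n k : ℕ} (hnk : n ≤ k) {L : Word → ℝ} (hL : EdgeLengths L) {x y : X}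
    (hx : x ∈ S.vert n) (hy : y ∈ S.vert n) : S.preDist k L x y = S.preDist n L x y := by
  induction n generalizing k L x y with
  | zero => exact S.preDist_boundary k hL hx hy
  | succ n ih =>
    obtain ⟨k, rfl⟩ : ∃ k', k = k' + 1 := ⟨k - 1, by omega⟩
    exact Finset.sum_congr rfl fun a _ =>
      ih (by omega) (hL.subtree a) (S.retr_mem_vert a hx) (S.retr_mem_vert a hy)

open Classical in
/-- The indicator function of the complement of the boundary `{c0, c1}`. -/
def offBoundary (x : X) : ℝ := if x ∈ S.vert 0 then 0 else 1

theorem offBoundary_nonneg (x : X) : 0 ≤ S.offBoundary x := by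
  unfold offBoundary
  split_ifs <;> norm_num

/-- At most one of the retractions of a point to the three cells is not a boundary point. -/
theorem sum_offBoundary_retr_le (x : X) : ∑ a, S.offBoundary (S.retr a x) ≤ S.offBoundary x := by
  by_cases hx : x ∈ S.vert 0
  · simp [offBoundary, hx, S.retr_boundary hx]
  · obtain ⟨b, y, rfl⟩ := S.cover x
    have h : ∀ a, S.offBoundary (S.retr a (S.toFun b y)) ≤ if a = b then 1 else 0 := by
      intro a
      split_ifs with hab
      · unfold offBoundary
        split_ifs <;> norm_num
      · rw [S.retr_of_ne hab, offBoundary, if_pos (S.c0_mem_vert 0)]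
    refine (Finset.sum_le_sum fun a _ => h a).trans ?_
    simp [offBoundary, hx]

/-- Consecutive approximations differ only through the at most two cells of level `n` whose
interiors contain `x` or `y`. -/
theorem abs_preDist_succ_sub_le (n : ℕ) {L : Word → ℝ} (hL : EdgeLengths L) {C θ : ℝ}
    (hθ0 : 0 ≤ θ) (hθ1 : θ < 1) (h : ∀ i, L i ≤ C * θ ^ i.length) (x y : X) :
    |S.preDist (n + 1) L x y - S.preDist n L x y| ≤
      4 * C * θ ^ n * (S.offBoundary x + S.offBoundary y) := by
  induction n generalizing L C x y with
  | zero =>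
    by_cases hxy : x ∈ S.vert 0 ∧ y ∈ S.vert 0
    · rw [S.preDist_boundary 1 hL hxy.1 hxy.2]
      simp [offBoundary, hxy.1, hxy.2]
    · have hC : 0 ≤ C := by simpa using (hL.pos []).le.trans (h [])
      have h1 : 1 ≤ S.offBoundary x + S.offBoundary y := by
        have hx0 := S.offBoundary_nonneg x
        have hy0 := S.offBoundary_nonneg y
        rcases not_and_or.1 hxy with hx | hx
        · have : S.offBoundary x = 1 := if_neg hx
          linarith
        · have : S.offBoundary y = 1 := if_neg hx
          linarith
      have hb : ∀ (L' : Word → ℝ), EdgeLengths L' → L' [] ≤ C → ∀ u v,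
          0 ≤ S.preDist 0 L' u v ∧ S.preDist 0 L' u v ≤ C := by
        intro L' hL' hC' u v
        refine ⟨S.preDist_nonneg 0 hL' u v, ?_⟩
        have := mul_le_mul_of_nonneg_left (S.abs_chi_sub_le u v) (hL'.pos []).le
        exact this.trans (by linarith)
      have h0 := hb L hL (by simpa using h []) x y
      have h3 : ∀ a, subtreeLength L a [] ≤ C := fun a => by
        have := h [a]
        simp only [List.length_singleton, pow_one] at this
        exact this.trans (by nlinarith)
      have e : S.preDist 1 L x y =
          ∑ a, S.preDist 0 (subtreeLength L a) (S.retr a x) (S.retr a y) := rfl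
      rw [e, Fin.sum_univ_three, abs_le, pow_zero, mul_one]
      have t0 := hb _ (hL.subtree 0) (h3 0) (S.retr 0 x) (S.retr 0 y)
      have t1 := hb _ (hL.subtree 1) (h3 1) (S.retr 1 x) (S.retr 1 y)
      have t2 := hb _ (hL.subtree 2) (h3 2) (S.retr 2 x) (S.retr 2 y)
      constructor <;> nlinarith
  | succ n ih =>
    have hC : 0 ≤ C := by simpa using (hL.pos []).le.trans (h [])
    have h' : ∀ a i, subtreeLength L a i ≤ C * θ * θ ^ i.length := fun a i => by
      refine (h (a :: i)).trans (le_of_eq ?_)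
      rw [List.length_cons, pow_succ]
      ring
    have e : S.preDist (n + 1 + 1) L x y - S.preDist (n + 1) L x y =
        ∑ a, (S.preDist (n + 1) (subtreeLength L a) (S.retr a x) (S.retr a y) -
          S.preDist n (subtreeLength L a) (S.retr a x) (S.retr a y)) := by
      rw [Finset.sum_sub_distrib]
      rfl
    rw [e]
    refine (Finset.abs_sum_le_sum_abs _ _).trans
      ((Finset.sum_le_sum fun a _ => ih (hL.subtree a) (h' a) _ _).trans ?_)
    rw [← Finset.mul_sum, Finset.sum_add_distrib]
    have h1 := S.sum_offBoundary_retr_le x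
    have h2 := S.sum_offBoundary_retr_le y
    calc _ ≤ 4 * (C * θ) * θ ^ n * (S.offBoundary x + S.offBoundary y) :=
          mul_le_mul_of_nonneg_left (add_le_add h1 h2) (by positivity)
      _ = _ := by ring

/-- The resistance metric of the edge lengths `L`. -/
def resDist (L : Word → ℝ) (x y : X) : ℝ := limUnder atTop fun n => S.preDist n L x y

theorem exists_dist_preDist_succ_le {L : Word → ℝ} (hL : EdgeLengths L) :
    ∃ C θ : ℝ, θ < 1 ∧ 0 ≤ θ ∧ ∀ x y n,
      dist (S.preDist n L x y) (S.preDist (n + 1) L x y) ≤ C * θ ^ n := by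
  obtain ⟨C, θ, h0, h1, h⟩ := hL.decay
  have hC : 0 ≤ C := by simpa using (hL.pos []).le.trans (h [])
  refine ⟨8 * C, θ, h1, h0, fun x y n => ?_⟩
  rw [dist_comm, Real.dist_eq]
  refine (S.abs_preDist_succ_sub_le n hL h0 h1 h x y).trans ?_
  have hb : ∀ z, S.offBoundary z ≤ 1 := fun z => by
    unfold offBoundary
    split_ifs <;> norm_num
  calc _ ≤ 4 * C * θ ^ n * (1 + 1) :=
        mul_le_mul_of_nonneg_left (add_le_add (hb x) (hb y)) (by positivity)
    _ = _ := by ring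

theorem tendsto_preDist {L : Word → ℝ} (hL : EdgeLengths L) (x y : X) :
    Tendsto (fun n => S.preDist n L x y) atTop (𝓝 (S.resDist L x y)) := by
  obtain ⟨C, θ, h1, -, h⟩ := S.exists_dist_preDist_succ_le hL
  exact (cauchySeq_of_le_geometric θ C h1 (h x y)).tendsto_limUnder

theorem continuous_resDist [CompactSpace X] {L : Word → ℝ} (hL : EdgeLengths L) :
    Continuous fun p : X × X => S.resDist L p.1 p.2 := by
  obtain ⟨C, θ, h1, h0, h⟩ := S.exists_dist_preDist_succ_le hL
  have hu : TendstoUniformly (fun n (p : X × X) => S.preDist n L p.1 p.2)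
      (fun p : X × X => S.resDist L p.1 p.2) atTop := by
    rw [Metric.tendstoUniformly_iff]
    intro ε hε
    have hlim : Tendsto (fun n : ℕ => C * θ ^ n / (1 - θ)) atTop (𝓝 (C * 0 / (1 - θ))) :=
      ((tendsto_pow_atTop_nhds_zero_of_lt_one h0 h1).const_mul C).div_const _
    rw [mul_zero, zero_div] at hlim
    filter_upwards [hlim.eventually (gt_mem_nhds hε)] with n hn p
    rw [dist_comm]
    exact (dist_le_of_le_geometric_of_tendsto θ C h1 (h p.1 p.2)
      (S.tendsto_preDist hL p.1 p.2) n).trans_lt hn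
  exact hu.continuous (Frequently.of_forall fun n => S.continuous_preDist n L)

theorem tendsto_resDist [CompactSpace X] {L : Word → ℝ} (hL : EdgeLengths L) {xs ys : ℕ → X}
    {x y : X} (hx : Tendsto xs atTop (𝓝 x)) (hy : Tendsto ys atTop (𝓝 y)) :
    Tendsto (fun n => S.resDist L (xs n) (ys n)) atTop (𝓝 (S.resDist L x y)) :=
  Tendsto.comp (g := fun p : X × X => S.resDist L p.1 p.2) (f := fun n => (xs n, ys n))
    ((S.continuous_resDist hL).tendsto (x, y)) (hx.prodMk_nhds hy)

theorem resDist_self {L : Word → ℝ} (hL : EdgeLengths L) (x : X) : S.resDist L x x = 0 :=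
  tendsto_nhds_unique (S.tendsto_preDist hL x x) (by simp [preDist_self])

theorem resDist_comm (L : Word → ℝ) (x y : X) : S.resDist L x y = S.resDist L y x := by
  simp only [resDist, S.preDist_comm _ _ x y]

theorem resDist_nonneg {L : Word → ℝ} (hL : EdgeLengths L) (x y : X) : 0 ≤ S.resDist L x y :=
  ge_of_tendsto' (S.tendsto_preDist hL x y) fun n => S.preDist_nonneg n hL x y

theorem resDist_triangle {L : Word → ℝ} (hL : EdgeLengths L) (x y z : X) :
    S.resDist L x z ≤ S.resDist L x y + S.resDist L y z :=
  le_of_tendsto_of_tendsto' (S.tendsto_preDist hL x z)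
    ((S.tendsto_preDist hL x y).add (S.tendsto_preDist hL y z))
    fun n => S.preDist_triangle n hL x y z

theorem resDist_eq_preDist {n : ℕ} {L : Word → ℝ} (hL : EdgeLengths L) {x y : X}
    (hx : x ∈ S.vert n) (hy : y ∈ S.vert n) : S.resDist L x y = S.preDist n L x y :=
  tendsto_nhds_unique (S.tendsto_preDist hL x y)
    (tendsto_const_nhds.congr' ((eventually_ge_atTop n).mono fun _ hk =>
      (S.preDist_eq_of_le hk hL hx hy).symm))

theorem resDist_c0_c1 {L : Word → ℝ} (hL : EdgeLengths L) : S.resDist L S.c0 S.c1 = L [] := by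
  rw [S.resDist_eq_preDist hL (S.c0_mem_vert 0) (S.c1_mem_vert 0), preDist_zero_c0_c1]

/-- Self-similarity of the resistance metric: it is the sum of the resistance metrics of the cells
between the retractions of the two points. -/
theorem resDist_eq_sum {L : Word → ℝ} (hL : EdgeLengths L) (x y : X) :
    S.resDist L x y = ∑ a, S.resDist (subtreeLength L a) (S.retr a x) (S.retr a y) :=
  tendsto_nhds_unique ((tendsto_add_atTop_iff_nat 1).2 (S.tendsto_preDist hL x y))
    (tendsto_finsetSum _ fun a _ => S.tendsto_preDist (hL.subtree a) _ _)

theorem resDist_toFun {L : Word → ℝ} (hL : EdgeLengths L) (a : Fin 3) (x y : X) :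
    S.resDist L (S.toFun a x) (S.toFun a y) = S.resDist (subtreeLength L a) x y := by
  rw [S.resDist_eq_sum hL, Finset.sum_eq_single a, retr_self, retr_self]
  · intro b _ hb
    rw [S.retr_of_ne hb, S.retr_of_ne hb, S.resDist_self (hL.subtree b)]
  · simp

theorem resDist_toFun_of_ne {L : Word → ℝ} (hL : EdgeLengths L) {a b : Fin 3} (hab : a ≠ b)
    (x y : X) : S.resDist L (S.toFun a x) (S.toFun b y) =
      S.resDist (subtreeLength L a) x S.c0 + S.resDist (subtreeLength L b) S.c0 y := by
  rw [S.resDist_eq_sum hL, Finset.sum_eq_add a b hab, retr_self, retr_self, S.retr_of_ne hab,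
    S.retr_of_ne hab.symm]
  · rintro d _ ⟨hda, hdb⟩
    rw [S.retr_of_ne hda, S.retr_of_ne hdb, S.resDist_self (hL.subtree d)]
  all_goals simp

theorem resDist_retr_le {L : Word → ℝ} (hL : EdgeLengths L) (a : Fin 3) (x y : X) :
    S.resDist (subtreeLength L a) (S.retr a x) (S.retr a y) ≤ S.resDist L x y := by
  rw [S.resDist_eq_sum hL x y]
  exact Finset.single_le_sum
    (f := fun a => S.resDist (subtreeLength L a) (S.retr a x) (S.retr a y))
    (fun b _ => S.resDist_nonneg (hL.subtree b) _ _) (Finset.mem_univ a)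

theorem Sep.resDist_pos {S : StarIFS X} {i : Word} {x y : X} (h : S.Sep i x y) {L : Word → ℝ}
    (hL : EdgeLengths L) : 0 < S.resDist L x y := by
  induction i generalizing L x y with
  | nil =>
    rcases h with ⟨rfl, rfl⟩ | ⟨rfl, rfl⟩
    · exact (S.resDist_c0_c1 hL).symm ▸ hL.pos []
    · exact (S.resDist_comm L _ _).symm ▸ (S.resDist_c0_c1 hL).symm ▸ hL.pos []
  | cons a i ih => exact (ih h (hL.subtree a)).trans_le (S.resDist_retr_le hL a x y)

theorem resDist_pos [CompactSpace X] {L : Word → ℝ} (hL : EdgeLengths L) {x y : X} (h : x ≠ y) :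
    0 < S.resDist L x y := by
  obtain ⟨i, hi⟩ := S.exists_sep h
  exact hi.resDist_pos hL

/-- The resistance metric as a metric space structure on `X`. -/
abbrev resMetric [CompactSpace X] {L : Word → ℝ} (hL : EdgeLengths L) : MetricSpace X where
  dist := S.resDist L
  dist_self := S.resDist_self hL
  dist_comm := S.resDist_comm L
  dist_triangle := S.resDist_triangle hL
  eq_of_dist_eq_zero {x y} h := by
    by_contra hxy
    exact (S.resDist_pos hL hxy).ne' h

/-- The resistance metric induces the given compact topology: it is continuous, and a continuous
bijection from a compact space to a Hausdorff space is a homeomorphism. -/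
theorem metricTopology_resMetric {X : Type*} [hX : MetricSpace X] [CompactSpace X] (S : StarIFS X)
    {L : Word → ℝ} (hL : EdgeLengths L) :
    metricTopology (S.resMetric hL) = metricTopology hX := by
  have hcont : @Continuous X X (metricTopology hX) (metricTopology (S.resMetric hL)) id := by
    refine @continuous_iff_continuousAt X X (metricTopology hX) (metricTopology (S.resMetric hL)) id
      |>.2 fun x => ?_
    refine (@tendsto_iff_dist_tendsto_zero X X (S.resMetric hL).toPseudoMetricSpace _ _ _).2 ?_
    have h := ((S.continuous_resDist hL).comp (continuous_id.prodMk continuous_const)).tendsto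
      (f := fun y => S.resDist L y x) x
    rw [S.resDist_self hL] at h
    exact h
  have hle := continuous_id_iff_le.1 hcont
  refine le_antisymm ?_ hle
  have ht2 : @T2Space X (metricTopology (S.resMetric hL)) :=
    letI := S.resMetric hL
    inferInstance
  let e := @Continuous.homeoOfEquivCompactToT2 X X (metricTopology hX)
    (metricTopology (S.resMetric hL)) _ ht2 (Equiv.refl X) hcont
  exact continuous_id_iff_le.1 (@Homeomorph.continuous_symm X X (metricTopology hX)
    (metricTopology (S.resMetric hL)) e)

end StarIFS

namespace StarIFS

variable {X : Type*} [MetricSpace X] (S : StarIFS X)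

/-! ### Energies and the effective resistance -/

/-- The energy of level `n` of a function: the sum over the cells `w` of level `n` of
`(L w)⁻¹` times the squared increment of the function across the cell. -/
def cellEnergy : ℕ → (Word → ℝ) → (X → ℝ) → ℝ
  | 0, L, f => 1 / L [] * (f S.c0 - f S.c1) ^ 2
  | n + 1, L, f => ∑ a, cellEnergy n (subtreeLength L a) (f ∘ S.toFun a)

theorem cellEnergy_nonneg (n : ℕ) {L : Word → ℝ} (hL : EdgeLengths L) (f : X → ℝ) :
    0 ≤ S.cellEnergy n L f := by
  induction n generalizing L f with
  | zero => exact mul_nonneg (one_div_nonneg.2 (hL.pos _).le) (sq_nonneg _)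
  | succ n ih => exact Finset.sum_nonneg fun a _ => ih (hL.subtree a) _

theorem cellEnergy_affine (n : ℕ) (L : Word → ℝ) (f : X → ℝ) (s t : ℝ) :
    S.cellEnergy n L (fun x => s * f x + t) = s ^ 2 * S.cellEnergy n L f := by
  induction n generalizing L f with
  | zero => simp only [cellEnergy]; ring
  | succ n ih =>
    simp only [cellEnergy, Finset.mul_sum]
    exact Finset.sum_congr rfl fun a _ => ih _ (f ∘ S.toFun a)

/-- Among the functions on the vertices of level `n`, none changes faster than the resistance
metric allows. -/
theorem sub_sq_le_preDist_mul_cellEnergy {n : ℕ} {L : Word → ℝ} (hL : EdgeLengths L) (f : X → ℝ)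
    {x y : X} (hx : x ∈ S.vert n) (hy : y ∈ S.vert n) :
    (f x - f y) ^ 2 ≤ S.preDist n L x y * S.cellEnergy n L f := by
  induction n generalizing L f x y with
  | zero =>
    have hpos := hL.pos []
    rcases hx with rfl | rfl <;> rcases hy with rfl | rfl <;>
      simp [preDist, cellEnergy, chi_c0, chi_c1] <;> field_simp <;> nlinarith
  | succ n ih =>
    rw [S.sub_eq_sum_retr f x y]
    exact Finset.sum_sq_le_sum_mul_sum_of_sq_le_mul _
      (fun a _ => S.preDist_nonneg n (hL.subtree a) _ _)
      (fun a _ => S.cellEnergy_nonneg n (hL.subtree a) _)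
      fun a _ => ih (hL.subtree a) (f ∘ S.toFun a) (S.retr_mem_vert a hx) (S.retr_mem_vert a hy)

/-- The function `R(x,·) - R(y,·)` has constant slope along the path from `x` to `y` and is constant
elsewhere, which determines its energy. -/
theorem cellEnergy_resDist_sub {n : ℕ} {L : Word → ℝ} (hL : EdgeLengths L)
    {x y : X} (hx : x ∈ S.vert n) (hy : y ∈ S.vert n) :
    S.cellEnergy n L (fun z => S.resDist L x z - S.resDist L y z) = 4 * S.resDist L x y := by
  induction n generalizing L x y with
  | zero =>
    have hpos := (hL.pos []).ne'
    have h01 := S.resDist_c0_c1 hL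
    have h10 := h01
    rw [S.resDist_comm] at h10
    rcases hx with rfl | rfl <;> rcases hy with rfl | rfl <;>
      simp [cellEnergy, S.resDist_self hL, h01, h10] <;> field_simp <;> ring
  | succ n ih =>
    simp only [cellEnergy]
    rw [S.resDist_eq_sum hL, Finset.mul_sum]
    refine Finset.sum_congr rfl fun a _ => ?_
    rw [← ih (hL.subtree a) (S.retr_mem_vert a hx) (S.retr_mem_vert a hy)]
    -- Inside the cell `a` the distance to a point is, up to a constant, the distance to its
    -- retraction.
    have hcell : ∀ p z, S.resDist L p (S.toFun a z) =
        S.resDist (subtreeLength L a) (S.retr a p) z +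
          ∑ b ∈ Finset.univ.erase a, S.resDist (subtreeLength L b) (S.retr b p) S.c0 := by
      intro p z
      rw [S.resDist_eq_sum hL, ← Finset.add_sum_erase _ _ (Finset.mem_univ a), retr_self]
      congr 1
      refine Finset.sum_congr rfl fun b hb => ?_
      rw [S.retr_of_ne (Finset.ne_of_mem_erase hb)]
    have : (fun z => S.resDist L x z - S.resDist L y z) ∘ S.toFun a = fun z =>
        1 * (S.resDist (subtreeLength L a) (S.retr a x) z -
          S.resDist (subtreeLength L a) (S.retr a y) z) +
        (∑ b ∈ Finset.univ.erase a, S.resDist (subtreeLength L b) (S.retr b x) S.c0 -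
          ∑ b ∈ Finset.univ.erase a, S.resDist (subtreeLength L b) (S.retr b y) S.c0) := by
      funext z
      simp only [Function.comp_apply, hcell]
      ring
    rw [this, cellEnergy_affine]
    ring

/-- The potential that equals `0` at `x` and `1` at `y` and minimises the energy. -/
def potential (L : Word → ℝ) (x y : X) (z : X) : ℝ :=
  1 / (2 * S.resDist L x y) * (S.resDist L x z - S.resDist L y z) + 1 / 2

theorem cellEnergy_potential {n : ℕ} {L : Word → ℝ} (hL : EdgeLengths L)
    {x y : X} (hx : x ∈ S.vert n) (hy : y ∈ S.vert n) (hxy : 0 < S.resDist L x y) :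
    S.cellEnergy n L (S.potential L x y) = (S.resDist L x y)⁻¹ := by
  unfold potential
  rw [cellEnergy_affine, S.cellEnergy_resDist_sub hL hx hy]
  field_simp
  ring

theorem potential_left {L : Word → ℝ} (hL : EdgeLengths L) {x y : X}
    (hxy : 0 < S.resDist L x y) : S.potential L x y x = 0 := by
  rw [potential, S.resDist_self hL, S.resDist_comm L y x]
  field_simp
  ring

theorem potential_right {L : Word → ℝ} (hL : EdgeLengths L) {x y : X}
    (hxy : 0 < S.resDist L x y) : S.potential L x y y = 1 := by
  rw [potential, S.resDist_self hL]
  field_simp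
  ring

/-! ### Geodesics -/

/-- `z` lies on the segment from `x` to `y`. -/
def Between (L : Word → ℝ) (x z y : X) : Prop :=
  S.resDist L x z + S.resDist L z y = S.resDist L x y

variable {S} in
theorem Between.retr {L : Word → ℝ} (hL : EdgeLengths L) {x z y : X} (h : S.Between L x z y)
    (a : Fin 3) : S.Between (subtreeLength L a) (S.retr a x) (S.retr a z) (S.retr a y) := by
  unfold Between at h ⊢
  rw [S.resDist_eq_sum hL x z, S.resDist_eq_sum hL z y, S.resDist_eq_sum hL x y,
    ← Finset.sum_add_distrib] at h
  exact ((Finset.sum_eq_sum_iff_of_le fun a _ =>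
    S.resDist_triangle (hL.subtree a) _ _ _).1 h.symm a (Finset.mem_univ a)).symm

/-- Two points of a segment lying in different cells, neither at the common point of the cells,
have different distances from the end point of the segment. -/
theorem resDist_ne_of_between [CompactSpace X] {L : Word → ℝ} (hL : EdgeLengths L) {x y z z' : X}
    {a b : Fin 3} (hab : a ≠ b) (hz : z ≠ S.c0) (hz' : z' ≠ S.c0)
    (h : S.Between L x (S.toFun a z) y) (h' : S.Between L x (S.toFun b z') y) :
    S.resDist L x (S.toFun a z) ≠ S.resDist L x (S.toFun b z') := by
  -- A segment contains a non-central point of a cell only if one of its end points is in the cell.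
  have hend : ∀ {d : Fin 3} {v : X}, v ≠ S.c0 → S.Between L x (S.toFun d v) y →
      (∃ u, S.toFun d u = x) ∨ ∃ u, S.toFun d u = y := by
    intro d v hv hb
    by_contra! hne
    have hr : ∀ p, (∀ u, S.toFun d u ≠ p) → S.retr d p = S.c0 := fun p hp => by
      obtain ⟨e, q, rfl⟩ := S.cover p
      exact S.retr_of_ne (fun hde => hp q (by rw [hde])) q
    have h1 := hb.retr hL d
    rw [hr x hne.1, hr y hne.2, retr_self, Between, S.resDist_self (hL.subtree d)] at h1
    linarith [S.resDist_pos (hL.subtree d) hv, S.resDist_nonneg (hL.subtree d) S.c0 v]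
  have main : ∀ {x y z z' : X} {a b : Fin 3}, a ≠ b → z ≠ S.c0 → z' ≠ S.c0 →
      S.Between L x (S.toFun a z) y → (∃ u, S.toFun a u = x) → (∃ v, S.toFun b v = y) →
      S.resDist L x (S.toFun a z) < S.resDist L x (S.toFun b z') := by
    rintro x y z z' a b hab hz hz' h ⟨u, rfl⟩ ⟨v, rfl⟩
    have h1 := h.retr hL a
    rw [retr_self, retr_self, S.retr_of_ne hab, Between] at h1
    rw [S.resDist_toFun hL, S.resDist_toFun_of_ne hL hab]
    have h2 := S.resDist_pos (hL.subtree a) hz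
    have h3 := S.resDist_nonneg (hL.subtree b) S.c0 z'
    linarith
  rcases hend hz h with hx | hy
  · rcases hend hz' h' with hx' | hy'
    · -- Both cells contain `x`, so `x` is their common point, and `y` cannot be in both cells.
      obtain ⟨u, hu⟩ := hx
      obtain ⟨u', hu'⟩ := hx'
      by_cases hy : ∃ v, S.toFun b v = y
      · exact (main hab hz hz' h ⟨u, hu⟩ hy).ne
      · by_cases hy2 : ∃ v, S.toFun a v = y
        · exact (main hab.symm hz' hz h' ⟨u', hu'⟩ hy2).ne'
        · exfalso
          have hx0 := S.inter a b u u' hab (hu.trans hu'.symm)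
          obtain ⟨e, q, rfl⟩ := S.cover y
          have hae : a ≠ e := fun hae => hy2 ⟨q, hae ▸ rfl⟩
          have h1 := h.retr hL a
          rw [← hu, retr_self, retr_self, hx0, S.retr_of_ne hae, Between,
            S.resDist_self (hL.subtree a)] at h1
          linarith [S.resDist_pos (hL.subtree a) hz, S.resDist_nonneg (hL.subtree a) S.c0 z]
    · exact (main hab hz hz' h hx hy').ne
  · rcases hend hz' h' with hx' | hy'
    · exact (main hab.symm hz' hz h' hx' hy).ne'
    · by_cases hx : ∃ u, S.toFun a u = x
      · exact (main hab hz hz' h hx hy').ne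
      · by_cases hx2 : ∃ u, S.toFun b u = x
        · exact (main hab.symm hz' hz h' hx2 hy).ne'
        · exfalso
          obtain ⟨v, hv⟩ := hy
          obtain ⟨v', hv'⟩ := hy'
          have hy0 := S.inter a b v v' hab (hv.trans hv'.symm)
          obtain ⟨e, q, rfl⟩ := S.cover x
          have hae : a ≠ e := fun hae => hx ⟨q, hae ▸ rfl⟩
          have h1 := h.retr hL a
          rw [← hv, retr_self, retr_self, hy0, S.retr_of_ne hae, Between,
            S.resDist_self (hL.subtree a)] at h1
          linarith [S.resDist_pos (hL.subtree a) hz, S.resDist_nonneg (hL.subtree a) S.c0 z]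

/-- A segment contains at most one point at a given distance from its end point. -/
theorem between_unique [CompactSpace X] {L : Word → ℝ} (hL : EdgeLengths L) {x y z z' : X}
    (h : S.Between L x z y) (h' : S.Between L x z' y)
    (heq : S.resDist L x z = S.resDist L x z') : z = z' := by
  refine S.eq_of_descent (fun (p : (Word → ℝ) × X × X) z z' => EdgeLengths p.1 ∧
    S.Between p.1 p.2.1 z p.2.2 ∧ S.Between p.1 p.2.1 z' p.2.2 ∧
      S.resDist p.1 p.2.1 z = S.resDist p.1 p.2.1 z') ?_ (l := (L, x, y)) ⟨hL, h, h', heq⟩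
  rintro ⟨L, x, y⟩ z z' ⟨hL, h, h', heq⟩
  dsimp only at hL h h' heq
  obtain ⟨a, z, rfl⟩ := S.cover z
  obtain ⟨b, z', rfl⟩ := S.cover z'
  have same : ∀ {a : Fin 3} {z z' : X}, S.Between L x (S.toFun a z) y →
      S.Between L x (S.toFun a z') y →
      S.resDist L x (S.toFun a z) = S.resDist L x (S.toFun a z') →
      ∃ d v v' l', S.toFun d v = S.toFun a z ∧ S.toFun d v' = S.toFun a z' ∧
        (fun (p : (Word → ℝ) × X × X) z z' => EdgeLengths p.1 ∧
          S.Between p.1 p.2.1 z p.2.2 ∧ S.Between p.1 p.2.1 z' p.2.2 ∧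
            S.resDist p.1 p.2.1 z = S.resDist p.1 p.2.1 z') l' v v' := by
    intro a z z' h h' heq
    refine ⟨a, z, z', (subtreeLength L a, S.retr a x, S.retr a y), rfl, rfl, hL.subtree a, ?_, ?_,
      ?_⟩
    · simpa using h.retr hL a
    · simpa using h'.retr hL a
    · rw [S.resDist_eq_sum hL, S.resDist_eq_sum hL x, ← Finset.add_sum_erase _ _ (Finset.mem_univ a),
        ← Finset.add_sum_erase _ _ (Finset.mem_univ a), retr_self, retr_self] at heq
      have : ∀ v, ∑ b ∈ Finset.univ.erase a,
          S.resDist (subtreeLength L b) (S.retr b x) (S.retr b (S.toFun a v)) =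
          ∑ b ∈ Finset.univ.erase a, S.resDist (subtreeLength L b) (S.retr b x) S.c0 := fun v =>
        Finset.sum_congr rfl fun b hb => by rw [S.retr_of_ne (Finset.ne_of_mem_erase hb)]
      rw [this, this] at heq
      exact add_right_cancel heq
  by_cases hab : a = b
  · subst hab
    exact Or.inr (same h h' heq)
  · by_cases hz : z = S.c0
    · subst hz
      rw [S.glue a b] at h heq ⊢
      exact Or.inr (same h h' heq)
    · by_cases hz' : z' = S.c0
      · subst hz'
        rw [S.glue b a] at h' heq ⊢
        exact Or.inr (same h h' heq)
      · exact (S.resDist_ne_of_between hL hab hz hz' h h' heq).elim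

/-- If the word `i` separates `x` and `y`, then the centre of the cell `i` lies on the segment
between them. -/
theorem Sep.between {S : StarIFS X} {i : Word} {x y : X} (h : S.Sep i x y) {L : Word → ℝ}
    (hL : EdgeLengths L) : S.Between L x (S.wordMap i (S.toFun 0 S.c0)) y := by
  induction i generalizing L x y with
  | nil =>
    have hm : S.Between L S.c0 (S.toFun 0 S.c0) S.c1 := by
      have h1 : S.resDist L S.c0 (S.toFun 0 S.c0) = L [0] := by
        conv_lhs => rw [← S.zero_c1, S.resDist_toFun hL, S.resDist_comm]
        rw [S.zero_c1, S.resDist_c0_c1 (hL.subtree 0)]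
        rfl
      have h2 : S.resDist L (S.toFun 0 S.c0) S.c1 = L [1] := by
        conv_lhs => rw [← S.one_c1, S.glue 0 1, S.resDist_toFun hL]
        rw [S.resDist_c0_c1 (hL.subtree 1)]
        rfl
      rw [Between, h1, h2, S.resDist_c0_c1 hL]
      exact (hL.split []).symm
    rcases h with ⟨rfl, rfl⟩ | ⟨rfl, rfl⟩
    · exact hm
    · rw [Between, S.resDist_comm L S.c1 S.c0, ← hm, S.resDist_comm L S.c1, add_comm]
      simp only [wordMap]
      rw [S.resDist_comm L _ S.c0]
  | cons a i ih =>
    have h1 : S.Between (subtreeLength L a) (S.retr a x) (S.wordMap i (S.toFun 0 S.c0))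
      (S.retr a y) := ih h (hL.subtree a)
    have hne : S.retr a x ≠ S.retr a y := by
      intro heq
      change S.Sep i (S.retr a x) (S.retr a y) at h
      rw [heq] at h
      rcases h with ⟨h2, h3⟩ | ⟨h2, h3⟩
      · exact S.ne (h2.symm.trans h3)
      · exact S.ne (h3.symm.trans h2)
    rw [Between, S.resDist_eq_sum hL x _, S.resDist_eq_sum hL _ y, S.resDist_eq_sum hL x y,
      ← Finset.sum_add_distrib]
    refine Finset.sum_congr rfl fun b _ => ?_
    by_cases hb : b = a
    · subst hb
      rw [wordMap, retr_self]
      exact h1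
    · have hc : S.retr b (S.wordMap (a :: i) (S.toFun 0 S.c0)) = S.c0 := S.retr_of_ne hb _
      have hor : S.retr b x = S.c0 ∨ S.retr b y = S.c0 := by
        obtain ⟨d, u, rfl⟩ := S.cover x
        obtain ⟨e, v, rfl⟩ := S.cover y
        by_cases hd : b = d
        · by_cases he : b = e
          · subst hd he
            rw [S.retr_of_ne (Ne.symm hb), S.retr_of_ne (Ne.symm hb)] at hne
            exact (hne rfl).elim
          · exact Or.inr (S.retr_of_ne he v)
        · exact Or.inl (S.retr_of_ne hd u)
      rw [hc]
      rcases hor with h0 | h0 <;> rw [h0, S.resDist_self (hL.subtree b)] <;> ring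

theorem Sep.ne_centre {S : StarIFS X} {i : Word} {x y : X} (h : S.Sep i x y) :
    x ≠ S.wordMap i (S.toFun 0 S.c0) := by
  rintro rfl
  have h0 : S.toFun 0 S.c0 ≠ S.c0 := fun h0 => by
    have := S.inj 0 (h0.trans S.zero_c1.symm)
    exact S.ne this
  have h1 : S.toFun 0 S.c0 ≠ S.c1 := fun h1 => by
    have := S.glue 0 1 ▸ h1
    exact S.ne (S.inj 1 (this.trans S.one_c1.symm))
  rcases h with ⟨h, -⟩ | ⟨h, -⟩ <;> rw [wordRetr_wordMap] at h
  exacts [h0 h, h1 h]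

variable {S} in
theorem Between.trans {L : Word → ℝ} (hL : EdgeLengths L) {x z y v : X} (h : S.Between L x z y)
    (hv : S.Between L z v y) :
    S.Between L x v y ∧ S.resDist L x v = S.resDist L x z + S.resDist L z v := by
  unfold Between at *
  have h1 := S.resDist_triangle hL x z v
  have h2 := S.resDist_triangle hL x v y
  constructor <;> linarith

variable {S} in
theorem Between.trans_left {L : Word → ℝ} (hL : EdgeLengths L) {x z y v : X}
    (h : S.Between L x z y) (hv : S.Between L x v z) : S.Between L x v y := by
  unfold Between at *
  have h1 := S.resDist_triangle hL v z y
  have h2 := S.resDist_triangle hL x v y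
  linarith

/-- A segment contains a point at every distance from its end point. -/
theorem exists_between [CompactSpace X] {L : Word → ℝ} (hL : EdgeLengths L) {x y : X} {s : ℝ}
    (hs0 : 0 ≤ s) (hs : s ≤ S.resDist L x y) :
    ∃ z, S.Between L x z y ∧ S.resDist L x z = s := by
  have hc := S.continuous_resDist hL
  have hcl : ∀ u v, IsClosed {z | S.Between L u z v} := fun u v => by
    refine isClosed_eq ?_ continuous_const
    exact (hc.comp (continuous_const.prodMk continuous_id)).add
      (hc.comp (continuous_id.prodMk continuous_const))
  have hcx : Continuous fun z => S.resDist L x z := hc.comp (continuous_const.prodMk continuous_id)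
  -- The last point `z` of the segment with distance at most `s`, and the first point `v` beyond
  -- `z` with distance at least `s`.
  obtain ⟨z, ⟨hz, hzs⟩, hzmax⟩ := ((hcl x y).inter (isClosed_le hcx continuous_const)).isCompact
    (s := {z | S.Between L x z y} ∩ {z | S.resDist L x z ≤ s}) |>.exists_isMaxOn
    ⟨x, by simp [Between, S.resDist_self hL], by simpa [S.resDist_self hL] using hs0⟩
    hcx.continuousOn
  refine ⟨z, hz, ?_⟩
  by_contra hne
  have hlt : S.resDist L x z < s := lt_of_le_of_ne hzs hne
  obtain ⟨v, ⟨hv, hvs⟩, hvmin⟩ := ((hcl z y).inter (isClosed_le continuous_const hcx)).isCompact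
    (s := {v | S.Between L z v y} ∩ {v | s ≤ S.resDist L x v}) |>.exists_isMinOn
    ⟨y, by simp [Between, S.resDist_self hL], hs⟩ hcx.continuousOn
  change s ≤ S.resDist L x v at hvs
  have hzv : z ≠ v := by
    rintro rfl
    linarith
  obtain ⟨i, hi⟩ := S.exists_sep hzv
  have hp := hi.between hL
  set p := S.wordMap i (S.toFun 0 S.c0)
  have hzp := S.resDist_pos hL hi.ne_centre
  have hpv := S.resDist_pos hL hi.symm.ne_centre.symm
  have hzpy := hv.trans_left hL hp
  obtain ⟨hxp, hdp⟩ := hz.trans hL hzpy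
  obtain ⟨-, hdv⟩ := hz.trans hL hv
  unfold Between at hp
  rcases le_total (S.resDist L x p) s with hps | hps
  · have : S.resDist L x p ≤ S.resDist L x z := hzmax ⟨hxp, hps⟩
    linarith
  · have : S.resDist L x v ≤ S.resDist L x p := hvmin ⟨hzpy, hps⟩
    linarith

/-- Two points are the end points of an arc, namely of a geodesic of the resistance metric. -/
theorem exists_isEmbedding {X : Type*} [MetricSpace X] [CompactSpace X] (S : StarIFS X)
    {L : Word → ℝ} (hL : EdgeLengths L) {x y : X} (hxy : x ≠ y) :
    ∃ γ : unitInterval → X, IsEmbedding γ ∧ γ 0 = x ∧ γ 1 = y := by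
  have hD := S.resDist_pos hL hxy
  set D := S.resDist L x y
  have hmem : ∀ t : unitInterval, 0 ≤ (t : ℝ) * D ∧ (t : ℝ) * D ≤ D := fun t =>
    ⟨mul_nonneg t.2.1 hD.le, mul_le_of_le_one_left hD.le t.2.2⟩
  choose γ hγ hγd using fun t : unitInterval => S.exists_between hL (hmem t).1 (hmem t).2
  have hγ0 : γ 0 = x := by
    by_contra h
    have := S.resDist_pos hL (Ne.symm h)
    rw [hγd] at this
    simp at this
  have hγ1 : γ 1 = y := by
    by_contra h
    have h1 := S.resDist_pos hL h
    have h2 := hγ 1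
    rw [Between, hγd] at h2
    simp only [Set.Icc.coe_one, one_mul] at h2
    linarith
  have hiso : ∀ s t : unitInterval, s ≤ t → S.resDist L (γ s) (γ t) = (t - s) * D := by
    intro s t hst
    have hst' : (s : ℝ) ≤ t := hst
    have h1 := hγ s
    rw [Between, hγd] at h1
    obtain ⟨v, hv, hvd⟩ := S.exists_between hL (x := γ s) (y := y) (s := (t - s) * D)
      (mul_nonneg (sub_nonneg.2 hst') hD.le) (by nlinarith [(hmem t).2])
    obtain ⟨hv1, hv2⟩ := (hγ s).trans hL hv
    have : v = γ t := S.between_unique hL hv1 (hγ t) (by rw [hv2, hvd, hγd, hγd]; ring)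
    rw [← this, hvd]
  have hiso' : ∀ s t : unitInterval, S.resDist L (γ s) (γ t) = |(s : ℝ) - t| * D := by
    intro s t
    rcases le_total s t with h | h
    · rw [hiso s t h, abs_sub_comm, abs_of_nonneg (sub_nonneg.2 (show (s : ℝ) ≤ t from h))]
    · rw [S.resDist_comm, hiso t s h, abs_of_nonneg (sub_nonneg.2 (show (t : ℝ) ≤ s from h))]
  have hinj : Function.Injective γ := by
    intro s t hst
    have := hiso' s t
    rw [hst, S.resDist_self hL] at this
    have h0 : |(s : ℝ) - t| = 0 := by
      rcases mul_eq_zero.1 this.symm with h | h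
      · exact h
      · exact (hD.ne' h).elim
    exact Subtype.ext (sub_eq_zero.1 (abs_eq_zero.1 h0))
  have hcont : Continuous γ := by
    have h1 : @Continuous _ X _ (metricTopology (S.resMetric hL)) γ := by
      refine @LipschitzWith.continuous _ X _ (S.resMetric hL).toPseudoEMetricSpace ⟨D, hD.le⟩ γ
        (@LipschitzWith.of_dist_le_mul _ X _ (S.resMetric hL).toPseudoMetricSpace ⟨D, hD.le⟩ γ
          fun s t => ?_)
      change S.resDist L (γ s) (γ t) ≤ D * |(s : ℝ) - t|
      rw [hiso', mul_comm]
    rwa [S.metricTopology_resMetric hL] at h1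
  exact ⟨γ, (hcont.isClosedEmbedding hinj).isEmbedding, hγ0, hγ1⟩

theorem isDendrite {X : Type*} [MetricSpace X] [CompactSpace X] (S : StarIFS X)
    {L : Word → ℝ} (hL : EdgeLengths L) : IsDendrite X where
  exists_arc _ _ h := S.exists_isEmbedding hL h
  no_circle := S.isEmpty_homeomorph_circle

end StarIFS

/-! ### The set `T` as a self-similar space -/

/-- A rhombus with diagonal from `(0,0)` to `(1,0)` that contains its images under the three
contractions. -/
def rhombus (c : ℝ) : Set Plane := {p | |p 1| ≤ 2 * c * p 0 ∧ |p 1| ≤ 2 * c * (1 - p 0)}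

theorem psi_mem_rhombus {c : ℝ} (hc : c ∈ Set.Ioo (0 : ℝ) (1 / 2)) (a : Fin 3) {p : Plane}
    (hp : p ∈ rhombus c) : psi c a p ∈ rhombus c := by
  obtain ⟨h0, h1⟩ := hc
  obtain ⟨h2, h3⟩ := hp
  rw [abs_le] at h2 h3
  have hx0 : 0 ≤ p 0 := by nlinarith
  have hx1 : p 0 ≤ 1 := by nlinarith
  fin_cases a <;> simp [psi, rhombus, abs_le]
  · refine ⟨⟨?_, ?_⟩, ?_, ?_⟩ <;> nlinarith
  · refine ⟨⟨?_, ?_⟩, ?_, ?_⟩ <;> nlinarith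
  · have hcc : c ^ 2 ≤ 1 / 4 := by nlinarith
    have h4 := mul_nonneg (sub_nonneg.2 hx1) (sub_nonneg.2 hcc)
    have k3 : -(1 - p 0) ≤ 2 * c * p 1 := by nlinarith
    have k4 : 2 * c * p 1 ≤ 1 - p 0 := by nlinarith
    refine ⟨⟨?_, ?_⟩, ?_, ?_⟩ <;> nlinarith

theorem T_subset_rhombus {c : ℝ} (hc : c ∈ Set.Ioo (0 : ℝ) (1 / 2)) : T c ⊆ rhombus c := by
  rw [T_eq_closure hc]
  refine closure_minimal ?_ ?_
  · intro p hp
    obtain ⟨i, b, rfl⟩ := mem_Vstar_iff.1 hp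
    clear hp
    induction i with
    | nil => fin_cases b <;> simp [psiWord, corner, rhombus, hc.1.le]
    | cons a i ih => exact psi_mem_rhombus hc a ih
  · change IsClosed ({p : Plane | |p 1| ≤ 2 * c * p 0} ∩ {p : Plane | |p 1| ≤ 2 * c * (1 - p 0)})
    refine IsClosed.inter (isClosed_le ?_ ?_) (isClosed_le ?_ ?_) <;> fun_prop

theorem psi_injective {c : ℝ} (hc : 0 < c) (a : Fin 3) : Function.Injective (psi c a) := by
  intro p q h
  have h0 := congrArg (fun r : Plane => r 0) h
  have h1 := congrArg (fun r : Plane => r 1) h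
  ext k
  fin_cases a <;> fin_cases k <;> simp [psi, hc.ne'] at h0 h1 ⊢ <;> linarith

/-- The three images of the rhombus meet only at `(1/2, 0)`, the image of `(0,0)`. -/
theorem eq_corner_of_psi_eq {c : ℝ} (hc : c ∈ Set.Ioo (0 : ℝ) (1 / 2)) {a b : Fin 3} (hab : a ≠ b)
    {p q : Plane} (hp : p ∈ rhombus c) (hq : q ∈ rhombus c) (h : psi c a p = psi c b q) :
    p = corner 0 := by
  obtain ⟨hc0, hc1⟩ := hc
  have h0 := congrArg (fun r : Plane => r 0) h
  have h1 := congrArg (fun r : Plane => r 1) h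
  obtain ⟨hp1, hp2⟩ := hp
  obtain ⟨hq1, hq2⟩ := hq
  rw [abs_le] at hp1 hp2 hq1 hq2
  have hcc : c ^ 2 < 1 / 4 := by nlinarith
  have px0 : 0 ≤ p 0 := by nlinarith
  have qx0 : 0 ≤ q 0 := by nlinarith
  suffices hx : p 0 = 0 by
    have hy : p 1 = 0 := by
      rw [hx] at hp1
      linarith
    ext k
    fin_cases k <;> simp [corner, hx, hy]
  have p0 := mul_nonneg px0 (sub_nonneg.2 hcc.le)
  have q0 := mul_nonneg qx0 (sub_nonneg.2 hcc.le)
  fin_cases a <;> fin_cases b <;> simp [psi] at hab h0 h1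
  · linarith
  · have : p 0 * (1 - 4 * c ^ 2) ≤ 0 := by nlinarith
    nlinarith
  · linarith
  · have : p 0 * (1 - 4 * c ^ 2) ≤ 0 := by nlinarith
    nlinarith
  · have : p 0 * (1 - 4 * c ^ 2) ≤ 0 := by nlinarith
    nlinarith
  · have : p 0 * (1 - 4 * c ^ 2) ≤ 0 := by nlinarith
    nlinarith

theorem psi_mem_T {c : ℝ} (hc : c ∈ Set.Ioo (0 : ℝ) (1 / 2)) (a : Fin 3) {p : Plane}
    (hp : p ∈ T c) : psi c a p ∈ T c := by
  rw [(isSelfSimilar_T hc).eq_iUnion]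
  exact Set.mem_iUnion.2 ⟨a, p, hp, rfl⟩

theorem corner_mem_T {c : ℝ} (hc : c ∈ Set.Ioo (0 : ℝ) (1 / 2)) (b : Fin 2) : corner b ∈ T c :=
  Vstar_subset_T hc (mem_Vstar_iff.2 ⟨[], b, rfl⟩)

/-- The self-similar structure of `T`. -/
def starIFS {c : ℝ} (hc : c ∈ Set.Ioo (0 : ℝ) (1 / 2)) : StarIFS (T c) where
  toFun a p := ⟨psi c a p, psi_mem_T hc a p.2⟩
  c0 := ⟨corner 0, corner_mem_T hc 0⟩
  c1 := ⟨corner 1, corner_mem_T hc 1⟩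
  ne h := by
    have := congrArg (fun r : T c => (r : Plane) 0) h
    simp [corner] at this
  dist_le a p q := dist_psi_le hc a p q
  inj a p q h := Subtype.ext (psi_injective hc.1 a (congrArg Subtype.val h))
  cover p := by
    obtain ⟨a, q, hq, h⟩ := Set.mem_iUnion.1 ((isSelfSimilar_T hc).eq_iUnion.subset p.2)
    exact ⟨a, ⟨q, hq⟩, Subtype.ext h⟩
  glue a b := by
    have h : ∀ a, psi c a (corner 0) = psi c 0 (corner 0) := fun a => by
      ext k
      fin_cases a <;> fin_cases k <;> simp [psi, corner]
    exact Subtype.ext ((h a).trans (h b).symm)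
  inter a b p q hab h := Subtype.ext (eq_corner_of_psi_eq hc hab (T_subset_rhombus hc p.2)
    (T_subset_rhombus hc q.2) (congrArg Subtype.val h))
  zero_c1 := Subtype.ext (psi_zero_corner c)
  one_c1 := Subtype.ext (psi_one_corner c)

theorem compactSpace_T {c : ℝ} (hc : c ∈ Set.Ioo (0 : ℝ) (1 / 2)) : CompactSpace (T c) :=
  isCompact_iff_compactSpace.1 (isSelfSimilar_T hc).isCompact

theorem coe_wordMap {c : ℝ} (hc : c ∈ Set.Ioo (0 : ℝ) (1 / 2)) (i : Word) (p : T c) :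
    ((starIFS hc).wordMap i p : Plane) = psiWord c i p := by
  induction i with
  | nil => rfl
  | cons a i ih =>
    change psi c a ((starIFS hc).wordMap i p) = psi c a (psiWord c i p)
    rw [ih]

theorem inclusion_vertex {c : ℝ} (hc : c ∈ Set.Ioo (0 : ℝ) (1 / 2)) (i : Word) (b : Fin 2) :
    Set.inclusion (Vstar_subset_T hc) (vertex c i b) =
      (starIFS hc).wordMap i ⟨corner b, corner_mem_T hc b⟩ :=
  Subtype.ext (coe_wordMap hc i ⟨corner b, corner_mem_T hc b⟩).symm

theorem exists_mem_vert {c : ℝ} (hc : c ∈ Set.Ioo (0 : ℝ) (1 / 2)) (x : Vstar c) :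
    ∃ n, Set.inclusion (Vstar_subset_T hc) x ∈ (starIFS hc).vert n := by
  obtain ⟨i, b, h⟩ := mem_Vstar_iff.1 x.2
  obtain rfl : vertex c i b = x := Subtype.ext h
  refine ⟨i.length, ?_⟩
  rw [inclusion_vertex]
  refine (starIFS hc).wordMap_mem_vert i ?_
  fin_cases b
  exacts [Or.inl rfl, Or.inr rfl]

/-! ### The resistance of the limit form -/

/-- The length `l(i) R_i` of the edge `i`. -/
def edgeLength (u : Word → ℝ) (i : Word) : ℝ := l u i * resistancePert u i

theorem sum_ofFn_eq_cellEnergy {X : Type*} [MetricSpace X] (S : StarIFS X) (n : ℕ)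
    (L : Word → ℝ) (f : X → ℝ) :
    ∑ i : Fin n → Fin 3, 1 / L (List.ofFn i) *
      (f (S.wordMap (List.ofFn i) S.c0) - f (S.wordMap (List.ofFn i) S.c1)) ^ 2 =
    S.cellEnergy n L f := by
  induction n generalizing L f with
  | zero => simp [StarIFS.cellEnergy, StarIFS.wordMap]
  | succ n ih =>
    rw [← (Fin.consEquiv fun _ => Fin 3).sum_comp, Fintype.sum_prod_type]
    refine Finset.sum_congr rfl fun a _ => ?_
    rw [← ih]
    refine Finset.sum_congr rfl fun i _ => ?_
    simp [Fin.consEquiv, StarIFS.wordMap, subtreeLength]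

theorem energy_comp_inclusion {c : ℝ} (hc : c ∈ Set.Ioo (0 : ℝ) (1 / 2)) (u : Word → ℝ) (n : ℕ)
    (f : T c → ℝ) :
    energy c u n (f ∘ Set.inclusion (Vstar_subset_T hc)) =
      (starIFS hc).cellEnergy n (edgeLength u) f := by
  rw [← sum_ofFn_eq_cellEnergy]
  refine Finset.sum_congr rfl fun i _ => ?_
  simp only [Function.comp_apply, inclusion_vertex hc]
  rfl

theorem exists_extension {c : ℝ} (hc : c ∈ Set.Ioo (0 : ℝ) (1 / 2)) (f : Vstar c → ℝ) :
    ∃ F : T c → ℝ, F ∘ Set.inclusion (Vstar_subset_T hc) = f :=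
  ⟨Function.extend (Set.inclusion (Vstar_subset_T hc)) f 0, funext fun x =>
    (Set.inclusion_injective (Vstar_subset_T hc)).extend_apply f 0 x⟩

/-- The variational resistance is the resistance metric: the Cauchy–Schwarz inequality along the
path from `x` to `y` bounds the energies from below, and the potential attains the bound. -/
theorem Rstar_eq_resDist {c : ℝ} (hc : c ∈ Set.Ioo (0 : ℝ) (1 / 2)) {u : Word → ℝ}
    (hL : EdgeLengths (edgeLength u)) (x y : Vstar c) :
    Rstar c u x y = (starIFS hc).resDist (edgeLength u)
      (Set.inclusion (Vstar_subset_T hc) x) (Set.inclusion (Vstar_subset_T hc) y) := by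
  have hcomp := compactSpace_T hc
  set S := starIFS hc
  set ι := Set.inclusion (Vstar_subset_T hc)
  rw [Rstar]
  split_ifs with hxy
  · rw [hxy, S.resDist_self hL]
  have hpos : 0 < S.resDist (edgeLength u) (ι x) (ι y) :=
    S.resDist_pos hL fun h => hxy (Set.inclusion_injective _ h)
  obtain ⟨nx, hx⟩ := exists_mem_vert hc x
  obtain ⟨ny, hy⟩ := exists_mem_vert hc y
  have hx' : ∀ n, max nx ny ≤ n → ι x ∈ S.vert n := fun n hn =>
    S.vert_mono ((le_max_left _ _).trans hn) hx
  have hy' : ∀ n, max nx ny ≤ n → ι y ∈ S.vert n := fun n hn =>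
    S.vert_mono ((le_max_right _ _).trans hn) hy
  have hleast : IsLeast {e : ℝ | ∃ f ∈ energyDomain c u, f x = 0 ∧ f y = 1 ∧
      limitEnergy c u f = e} (S.resDist (edgeLength u) (ι x) (ι y))⁻¹ := by
    constructor
    · have hlim : Tendsto (fun n => energy c u n (S.potential (edgeLength u) (ι x) (ι y) ∘ ι)) atTop
          (𝓝 (S.resDist (edgeLength u) (ι x) (ι y))⁻¹) := by
        refine tendsto_const_nhds.congr' ((eventually_ge_atTop (max nx ny)).mono fun n hn => ?_)
        beta_reduce
        rw [energy_comp_inclusion hc, S.cellEnergy_potential hL (hx' n hn) (hy' n hn) hpos]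
      exact ⟨_, ⟨_, hlim⟩, S.potential_left hL hpos, S.potential_right hL hpos, hlim.limUnder_eq⟩
    · rintro e ⟨f, ⟨e', he'⟩, hfx, hfy, rfl⟩
      rw [limitEnergy, he'.limUnder_eq]
      obtain ⟨F, rfl⟩ := exists_extension hc f
      have h1 : 1 ≤ S.resDist (edgeLength u) (ι x) (ι y) * e' := by
        refine ge_of_tendsto (he'.const_mul _)
          ((eventually_ge_atTop (max nx ny)).mono fun n hn => ?_)
        have h := S.sub_sq_le_preDist_mul_cellEnergy hL F (hx' n hn) (hy' n hn)
        rw [← S.resDist_eq_preDist hL (hx' n hn) (hy' n hn), ← energy_comp_inclusion hc] at h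
        change F (ι x) = 0 at hfx
        change F (ι y) = 1 at hfy
        rw [hfx, hfy] at h
        norm_num at h
        exact h
      rwa [inv_le_iff_one_le_mul₀' hpos]
  rw [hleast.csInf_eq, inv_inv]

theorem isCompletion_induced {X Y : Type*} [dY : MetricSpace Y] [CompactSpace Y] {ι : X → Y}
    (hι : Function.Injective ι) (hd : DenseRange ι) :
    IsCompletion (MetricSpace.induced ι hι dY) dY ι :=
  ⟨complete_of_compact, @Isometry.of_dist_eq _ _
    (MetricSpace.induced ι hι dY).toPseudoMetricSpace _ _ fun _ _ => rfl, hd⟩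

/-- The conclusions of the theorem on the resistance metric, for a realisation of the cascade
whose edge lengths are consistent and decay geometrically. -/
theorem exists_metric_of_edgeLengths {c : ℝ} (hc : c ∈ Set.Ioo (0 : ℝ) (1 / 2)) {u : Word → ℝ}
    (hL : EdgeLengths (edgeLength u)) :
    ∃ dstar : MetricSpace (Vstar c), (∀ x y, dstar.dist x y = Rstar c u x y) ∧
      ∃ R : MetricSpace (T c),
        (∀ (x y : T c) (xs ys : ℕ → Vstar c),
          Tendsto (fun n => (xs n : Plane)) atTop (𝓝 (x : Plane)) →
          Tendsto (fun n => (ys n : Plane)) atTop (𝓝 (y : Plane)) →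
          Tendsto (fun n => Rstar c u (xs n) (ys n)) atTop (𝓝 (R.dist x y))) ∧
        metricTopology R = (instTopologicalSpaceSubtype : TopologicalSpace (T c)) ∧
        @CompactSpace (T c) (metricTopology R) ∧ @IsDendrite (T c) (metricTopology R) ∧
        IsCompletion dstar R (Set.inclusion (Vstar_subset_T hc)) := by
  have hcomp := compactSpace_T hc
  have hden := (starIFS hc).isDendrite hL
  have hlim : ∀ (x y : T c) (xs ys : ℕ → Vstar c),
      Tendsto (fun n => (xs n : Plane)) atTop (𝓝 (x : Plane)) →
      Tendsto (fun n => (ys n : Plane)) atTop (𝓝 (y : Plane)) →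
      Tendsto (fun n => Rstar c u (xs n) (ys n)) atTop
        (𝓝 ((starIFS hc).resDist (edgeLength u) x y)) := by
    intro x y xs ys hx hy
    simp only [Rstar_eq_resDist hc hL]
    have hx' : Tendsto (fun n => Set.inclusion (Vstar_subset_T hc) (xs n)) atTop (𝓝 x) :=
      tendsto_subtype_rng.2 hx
    have hy' : Tendsto (fun n => Set.inclusion (Vstar_subset_T hc) (ys n)) atTop (𝓝 y) :=
      tendsto_subtype_rng.2 hy
    exact (starIFS hc).tendsto_resDist hL hx' hy'
  have hdense : DenseRange (Set.inclusion (Vstar_subset_T hc)) := by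
    intro x
    rw [Set.range_inclusion, closure_subtype]
    have : Subtype.val '' {x : T c | (x : Plane) ∈ Vstar c} = Vstar c := by
      rw [show {x : T c | (x : Plane) ∈ Vstar c} = Subtype.val ⁻¹' Vstar c from rfl,
        Subtype.image_preimage_coe, Set.inter_eq_right.2 (Vstar_subset_T hc)]
    rw [this, ← T_eq_closure hc]
    exact x.2
  have hRstar := Rstar_eq_resDist hc hL
  have htop := (starIFS hc).metricTopology_resMetric hL
  have hd : ∀ x y, ((starIFS hc).resMetric hL).dist x y =
      (starIFS hc).resDist (edgeLength u) x y := fun _ _ => rfl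
  generalize (starIFS hc).resDist (edgeLength u) = d at *
  generalize (starIFS hc).resMetric hL = R at *
  change _ = (instTopologicalSpaceSubtype : TopologicalSpace (T c)) at htop
  refine ⟨@MetricSpace.induced _ _ (Set.inclusion (Vstar_subset_T hc))
    (Set.inclusion_injective _) R, fun x y => (hd _ _).trans (hRstar x y).symm, R, ?_, htop, ?_,
      ?_, @isCompletion_induced _ _ R ?_ _ _ ?_⟩
  · simpa only [hd] using hlim
  all_goals
    first
    | rw [htop]; assumption
    | change @CompactSpace (T c) (metricTopology R); rw [htop]; assumption
    | change @Dense (T c) (metricTopology R) _; rw [htop]; assumption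

/-! ### Cascades on their canonical space -/

/-- A realisation of the cascade, given as the vector of the three weights attached to each
word. -/
abbrev Env : Type := Word → Fin 3 → unitInterval

/-- The realisation seen from the word `i`. -/
def subEnv (i : Word) (e : Env) : Env := fun k => e (i ++ k)

/-- The canonical law of a cascade whose weight vectors have law `μ`. -/
abbrev cascadeLaw (μ : Measure (Fin 3 → unitInterval)) [IsProbabilityMeasure μ] : Measure Env :=
  Measure.infinitePi fun _ => μ

theorem measurable_subEnv (i : Word) : Measurable (subEnv i) :=
  measurable_pi_lambda _ fun k => measurable_pi_apply (i ++ k)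

variable {μ : Measure (Fin 3 → unitInterval)} [IsProbabilityMeasure μ]

theorem measurePreserving_subEnv (i : Word) :
    MeasurePreserving (subEnv i) (cascadeLaw μ) (cascadeLaw μ) :=
  ⟨measurable_subEnv i, Measure.map_infinitePi_infinitePi_of_inj (List.append_right_injective i)⟩

/-- Branching property: the weights at the root and the realisations seen from two different
letters are independent. -/
theorem measurePreserving_branching {a b : Fin 3} (hab : a ≠ b) :
    MeasurePreserving (fun e : Env => (e [], subEnv [a] e, subEnv [b] e)) (cascadeLaw μ)
      (μ.prod ((cascadeLaw μ).prod (cascadeLaw μ))) := by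
  refine ⟨(measurable_pi_apply _).prodMk
    ((measurable_subEnv _).prodMk (measurable_subEnv _)), ?_⟩
  obtain ⟨d, hda, hdb⟩ : ∃ d : Fin 3, d ≠ a ∧ d ≠ b := by
    revert a b
    decide
  -- The root is embedded in a family of words, disjoint from the words that start with `a` or `b`,
  -- which is indexed by all words.
  let root : Word → Word := fun k => if k = [] then [] else d :: k
  let idx : Fin 3 × Word → Word := fun p =>
    if p.1 = 0 then root p.2 else if p.1 = 1 then a :: p.2 else b :: p.2
  have hidx : Function.Injective idx := by
    rintro ⟨p, k⟩ ⟨q, m⟩ h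
    fin_cases p <;> fin_cases q <;> simp [idx, root] at h ⊢ <;> (try split_ifs at h) <;>
      simp_all
  let toCopies : Env → Fin 3 → Env := fun e p k => e (idx (p, k))
  have hm : Measurable toCopies := by fun_prop
  have hcopies : (cascadeLaw μ).map toCopies = Measure.infinitePi fun _ => cascadeLaw μ := by
    have h1 := Measure.map_infinitePi_infinitePi_of_inj (P := fun _ : Word => μ) hidx
    have h2 := Measure.infinitePi_map_curry (fun (_ : Fin 3) (_ : Word) => μ)
    rw [← h2, ← h1, Measure.map_map (by fun_prop) (by fun_prop)]
    rfl
  have hind : iIndepFun (fun (p : Fin 3) (E : Fin 3 → Env) => E p)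
      (Measure.infinitePi fun _ => cascadeLaw μ) :=
    iIndepFun_infinitePi (X := fun _ E => E) fun _ => measurable_id
  have h12 : (Measure.infinitePi fun _ : Fin 3 => cascadeLaw μ).map (fun E => (E 1, E 2)) =
      (cascadeLaw μ).prod (cascadeLaw μ) := Measure.infinitePi_map_eval_prod (by decide)
  have h012 : (Measure.infinitePi fun _ : Fin 3 => cascadeLaw μ).map (fun E => (E 0, E 1, E 2)) =
      (cascadeLaw μ).prod ((cascadeLaw μ).prod (cascadeLaw μ)) := by
    have := (hind.indepFun_prodMk (fun p => measurable_pi_apply p) 1 2 0 (by decide)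
      (by decide)).symm
    rw [this.map_prod_eq_prod_map_map (measurable_pi_apply 0).aemeasurable
        ((measurable_pi_apply 1).prodMk (measurable_pi_apply 2)).aemeasurable, h12,
      Measure.infinitePi_map_eval]
  have hroot : (cascadeLaw μ).map (fun e : Env => e []) = μ := Measure.infinitePi_map_eval _ _
  have hrm : Measurable fun e : Env => e [] := measurable_pi_apply _
  have hfin : (cascadeLaw μ).map (fun e : Env => (e [], subEnv [a] e, subEnv [b] e)) =
      (((cascadeLaw μ).map toCopies).map (fun E => (E 0, E 1, E 2))).map
        (Prod.map (fun e : Env => e []) id) := by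
    rw [Measure.map_map (by fun_prop) hm, Measure.map_map (hrm.prodMap measurable_id) (by fun_prop)]
    rfl
  rw [hfin, hcopies, h012, ← Measure.map_prod_map _ _ hrm measurable_id, hroot, Measure.map_id]

theorem measurePreserving_root_subEnv (a : Fin 3) :
    MeasurePreserving (fun e : Env => (e [], subEnv [a] e)) (cascadeLaw μ)
      (μ.prod (cascadeLaw μ)) := by
  have hab : a ≠ a + 1 := by
    revert a
    decide
  have h := measurePreserving_branching (μ := μ) hab
  exact (((MeasurePreserving.id μ).prod measurePreserving_fst).comp h)

theorem measurePreserving_subEnv_prod {a b : Fin 3} (hab : a ≠ b) :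
    MeasurePreserving (fun e : Env => (subEnv [a] e, subEnv [b] e)) (cascadeLaw μ)
      ((cascadeLaw μ).prod (cascadeLaw μ)) :=
  measurePreserving_snd.comp (measurePreserving_branching (μ := μ) hab)

/-! ### The resistance martingale -/

/-- The sum of the products of weights along the words of length `n` in the first two letters. -/
def mart : ℕ → Env → ℝ
  | 0, _ => 1
  | n + 1, e => e [] 0 * mart n (subEnv [0] e) + e [] 1 * mart n (subEnv [1] e)

theorem mart_nonneg (n : ℕ) (e : Env) : 0 ≤ mart n e := by
  induction n generalizing e with
  | zero => exact zero_le_one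
  | succ n ih =>
    exact add_nonneg (mul_nonneg (e [] 0).2.1 (ih _)) (mul_nonneg (e [] 1).2.1 (ih _))

theorem mart_le (n : ℕ) (e : Env) : mart n e ≤ 2 ^ n := by
  induction n generalizing e with
  | zero => exact le_of_eq (by simp [mart])
  | succ n ih =>
    have h : ∀ a, (e [] a : ℝ) * mart n (subEnv [a] e) ≤ 2 ^ n := fun a =>
      (mul_le_of_le_one_left (mart_nonneg _ _) (e [] a).2.2).trans (ih _)
    rw [mart, pow_succ]
    linarith [h 0, h 1]

theorem measurable_mart (n : ℕ) : Measurable (mart n) := by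
  induction n with
  | zero => exact measurable_const
  | succ n ih =>
    have h0 := ih.comp (measurable_subEnv [0])
    have h1 := ih.comp (measurable_subEnv [1])
    have hw : ∀ a, Measurable fun e : Env => (e [] a : ℝ) := fun a =>
      measurable_subtype_coe.comp ((measurable_pi_apply a).comp (measurable_pi_apply _))
    exact ((hw 0).mul h0).add ((hw 1).mul h1)

theorem measurable_weight (a : Fin 3) :
    Measurable fun x : Fin 3 → unitInterval => (x a : ℝ) :=
  measurable_subtype_coe.comp (measurable_pi_apply a)

/-- A bounded measurable function is integrable with respect to a finite measure. -/
theorem integrable_of_abs_le {α : Type*} [MeasurableSpace α] {m : Measure α} [IsFiniteMeasure m]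
    {f : α → ℝ} (hf : Measurable f) (C : ℝ) (h : ∀ x, |f x| ≤ C) : Integrable f m :=
  Integrable.of_bound hf.aestronglyMeasurable C (Eventually.of_forall h)

/-- Exponential moments of the martingale near the origin. The bound `exp (t + K t²)` is
preserved by one branching step because the expected sum of the squared weights is less than
`1`, which leaves room for the second-order term. -/
theorem integral_exp_mart_le (hA : ∫ x, ((x 0 : ℝ) + x 1) ∂μ = 1) {q : ℝ} (hq : q < 1)
    (hq0 : 0 ≤ q) (hqx : ∫ x, ((x 0 : ℝ) ^ 2 + (x 1 : ℝ) ^ 2) ∂μ = q) (n : ℕ) {t : ℝ}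
    (ht : 4 / (1 - q) * |t| ≤ 1) :
    ∫ e, Real.exp (t * mart n e) ∂cascadeLaw μ ≤ Real.exp (t + 4 / (1 - q) * t ^ 2) := by
  set K := 4 / (1 - q) with hK
  have h1q : 0 < 1 - q := sub_pos.2 hq
  have hK4 : 4 ≤ K := by
    rw [hK, le_div_iff₀ h1q]
    linarith
  have hKq : K * (1 - q) = 4 := div_mul_cancel₀ _ h1q.ne'
  induction n generalizing t with
  | zero =>
    simp only [mart, mul_one, integral_const, probReal_univ, one_smul]
    exact Real.exp_le_exp.2 (by nlinarith [sq_nonneg t])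
  | succ n ih =>
    set φ : ℝ → ℝ := fun s => ∫ e, Real.exp (s * mart n e) ∂cascadeLaw μ with hφ
    have hφ0 : ∀ s, 0 ≤ φ s := fun s => integral_nonneg fun e => (Real.exp_pos _).le
    have hstep : ∫ e, Real.exp (t * mart (n + 1) e) ∂cascadeLaw μ =
        ∫ x, φ (t * x 0) * φ (t * x 1) ∂μ := by
      set F : (Fin 3 → unitInterval) × Env × Env → ℝ := fun p =>
        Real.exp (t * p.1 0 * mart n p.2.1) * Real.exp (t * p.1 1 * mart n p.2.2) with hF
      have hmF : Measurable F := by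
        have hm := measurable_mart n
        have hw := measurable_weight
        exact (Real.measurable_exp.comp (((hw 0).comp measurable_fst).const_mul t |>.mul
            (hm.comp (measurable_fst.comp measurable_snd)))).mul
          (Real.measurable_exp.comp (((hw 1).comp measurable_fst).const_mul t |>.mul
            (hm.comp (measurable_snd.comp measurable_snd))))
      have hle : ∀ (y : unitInterval) (e : Env), t * y * mart n e ≤ |t| * 2 ^ n := by
        intro y e
        have h2 : (y : ℝ) * mart n e ≤ 2 ^ n :=
          (mul_le_of_le_one_left (mart_nonneg _ _) y.2.2).trans (mart_le n e)
        have h3 : 0 ≤ (y : ℝ) * mart n e := mul_nonneg y.2.1 (mart_nonneg _ _)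
        rw [mul_assoc]
        exact (mul_le_mul_of_nonneg_right (le_abs_self t) h3).trans
          (mul_le_mul_of_nonneg_left h2 (abs_nonneg t))
      have hbF : ∀ p, |F p| ≤ Real.exp (|t| * 2 ^ n) * Real.exp (|t| * 2 ^ n) := by
        intro p
        rw [abs_of_nonneg (by positivity)]
        exact mul_le_mul (Real.exp_le_exp.2 (hle _ _)) (Real.exp_le_exp.2 (hle _ _))
          (Real.exp_pos _).le (Real.exp_pos _).le
      have h1 : ∫ e, Real.exp (t * mart (n + 1) e) ∂cascadeLaw μ =
          ∫ e : Env, F (e [], subEnv [0] e, subEnv [1] e) ∂cascadeLaw μ := by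
        refine integral_congr_ae (Eventually.of_forall fun e => ?_)
        simp only [hF, ← Real.exp_add, mart]
        ring_nf
      have hmp := measurePreserving_branching (μ := μ) (show (0 : Fin 3) ≠ 1 by decide)
      rw [h1, ← integral_map hmp.measurable.aemeasurable
        (hmF.aestronglyMeasurable), hmp.map_eq,
        integral_prod _ (integrable_of_abs_le hmF _ hbF)]
      refine integral_congr_ae (Eventually.of_forall fun x => ?_)
      exact integral_prod_mul (fun e => Real.exp (t * x 0 * mart n e))
        (fun e => Real.exp (t * x 1 * mart n e))
    have hsmall : ∀ y : unitInterval, K * |t * y| ≤ 1 := fun y => by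
      rw [abs_mul, abs_of_nonneg y.2.1]
      have := mul_le_of_le_one_right (abs_nonneg t) y.2.2
      nlinarith
    have ht4 : |t| ≤ 1 / 4 := by nlinarith [abs_nonneg t]
    have hKt : K * t ^ 2 ≤ |t| := by
      rw [← sq_abs]
      nlinarith [abs_nonneg t]
    have hKt0 : 0 ≤ K * t ^ 2 := by positivity
    have htt : t ^ 2 = |t| ^ 2 := (sq_abs t).symm
    -- The exponent left over after one step has mean `-4 t²` and absolute value at most `2 |t|`.
    set Y : (Fin 3 → unitInterval) → ℝ := fun x =>
      t * ((x 0 : ℝ) + x 1 - 1) + K * t ^ 2 * ((x 0 : ℝ) ^ 2 + (x 1 : ℝ) ^ 2 - 1) with hY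
    have hmY : Measurable Y := by
      have h0 := measurable_weight 0
      have h1 := measurable_weight 1
      exact (((h0.add h1).sub_const 1).const_mul t).add
        ((((h0.pow_const 2).add (h1.pow_const 2)).sub_const 1).const_mul _)
    have hYb : ∀ x, |Y x| ≤ 2 * |t| := by
      intro x
      obtain ⟨a0, a1⟩ := (x 0).2
      obtain ⟨b0, b1⟩ := (x 1).2
      have e1 : |(x 0 : ℝ) + x 1 - 1| ≤ 1 := by
        rw [abs_le]
        constructor <;> linarith
      have e2 : |(x 0 : ℝ) ^ 2 + (x 1 : ℝ) ^ 2 - 1| ≤ 1 := by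
        rw [abs_le]
        constructor <;> nlinarith
      refine (abs_add_le _ _).trans ?_
      rw [abs_mul, abs_mul, abs_of_nonneg hKt0]
      have e3 := mul_le_of_le_one_right (abs_nonneg t) e1
      have e4 := mul_le_of_le_one_right hKt0 e2
      linarith
    have hYint : Integrable Y μ := integrable_of_abs_le hmY _ hYb
    have hYmean : ∫ x, Y x ∂μ = -4 * t ^ 2 := by
      have i1 : Integrable (fun x : Fin 3 → unitInterval => (x 0 : ℝ) + x 1) μ := by
        refine integrable_of_abs_le ((measurable_weight 0).add (measurable_weight 1)) 2 fun x => ?_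
        rw [abs_of_nonneg (add_nonneg (x 0).2.1 (x 1).2.1)]
        linarith [(x 0).2.2, (x 1).2.2]
      have i2 : Integrable (fun x : Fin 3 → unitInterval => (x 0 : ℝ) ^ 2 + (x 1 : ℝ) ^ 2) μ := by
        refine integrable_of_abs_le (((measurable_weight 0).pow_const 2).add
          ((measurable_weight 1).pow_const 2)) 2 fun x => ?_
        rw [abs_of_nonneg (by positivity)]
        nlinarith [(x 0).2.1, (x 1).2.1, (x 0).2.2, (x 1).2.2]
      have i3 : Integrable (fun x : Fin 3 → unitInterval => (x 0 : ℝ) + x 1 - 1) μ :=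
        i1.sub (integrable_const (1 : ℝ))
      have i4 : Integrable (fun x : Fin 3 → unitInterval =>
          (x 0 : ℝ) ^ 2 + (x 1 : ℝ) ^ 2 - 1) μ := i2.sub (integrable_const (1 : ℝ))
      change ∫ x : Fin 3 → unitInterval, (t * ((x 0 : ℝ) + x 1 - 1) +
        K * t ^ 2 * ((x 0 : ℝ) ^ 2 + (x 1 : ℝ) ^ 2 - 1)) ∂μ = _
      rw [integral_add (i3.const_mul t) (i4.const_mul (K * t ^ 2)), integral_const_mul,
        integral_const_mul, integral_sub i1 (integrable_const _),
        integral_sub i2 (integrable_const _), hA, hqx]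
      simp
      linear_combination -(t ^ 2) * hKq
    have hexpY : ∫ x, Real.exp (Y x) ∂μ ≤ 1 := by
      have hpt : ∀ x, Real.exp (Y x) ≤ 1 + 4 * t ^ 2 + Y x := fun x => by
        have h1 : |Y x| ≤ 1 := (hYb x).trans (by linarith)
        have h2 := (abs_le.1 (Real.abs_exp_sub_one_sub_id_le h1)).2
        have h3 : Y x ^ 2 ≤ 4 * t ^ 2 := by
          rw [← sq_abs (Y x), htt]
          nlinarith [hYb x, abs_nonneg (Y x), abs_nonneg t]
        linarith
      calc ∫ x, Real.exp (Y x) ∂μ ≤ ∫ x, (1 + 4 * t ^ 2 + Y x) ∂μ :=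
            integral_mono_of_nonneg (Eventually.of_forall fun x => (Real.exp_pos _).le)
              ((integrable_const _).add hYint) (Eventually.of_forall hpt)
        _ = 1 := by
            rw [integral_add (integrable_const _) hYint, hYmean]
            simp
    have hprod : ∀ x : Fin 3 → unitInterval, φ (t * x 0) * φ (t * x 1) ≤
        Real.exp (t + K * t ^ 2) * Real.exp (Y x) := fun x => by
      refine (mul_le_mul (ih (hsmall (x 0))) (ih (hsmall (x 1))) (hφ0 _)
        (Real.exp_pos _).le).trans (le_of_eq ?_)
      rw [← Real.exp_add, ← Real.exp_add, hY]
      ring_nf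
    have hint : Integrable (fun x => Real.exp (t + K * t ^ 2) * Real.exp (Y x)) μ := by
      refine (integrable_of_abs_le (Real.measurable_exp.comp hmY) (Real.exp (2 * |t|))
        fun x => ?_).const_mul _
      rw [Function.comp_apply, abs_of_pos (Real.exp_pos _)]
      exact Real.exp_le_exp.2 ((le_abs_self _).trans (hYb x))
    calc _ = ∫ x, φ (t * x 0) * φ (t * x 1) ∂μ := hstep
      _ ≤ ∫ x, Real.exp (t + K * t ^ 2) * Real.exp (Y x) ∂μ :=
          integral_mono_of_nonneg (Eventually.of_forall fun x => mul_nonneg (hφ0 _) (hφ0 _)) hint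
            (Eventually.of_forall hprod)
      _ = Real.exp (t + K * t ^ 2) * ∫ x, Real.exp (Y x) ∂μ := integral_const_mul _ _
      _ ≤ Real.exp (t + K * t ^ 2) := mul_le_of_le_one_right (Real.exp_pos _).le hexpY

theorem integral_root_mul (a : Fin 3) {g : (Fin 3 → unitInterval) → ℝ} {h : Env → ℝ}
    (hg : Measurable g) (hh : Measurable h) :
    ∫ e, g (e []) * h (subEnv [a] e) ∂cascadeLaw μ = (∫ x, g x ∂μ) * ∫ e, h e ∂cascadeLaw μ := by
  have hmp := measurePreserving_root_subEnv (μ := μ) a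
  rw [← integral_prod_mul g h, ← hmp.map_eq]
  exact (integral_map hmp.measurable.aemeasurable
    ((hg.comp measurable_fst).mul (hh.comp measurable_snd)).aestronglyMeasurable).symm

theorem integral_root_mul_mul {g : (Fin 3 → unitInterval) → ℝ} {h k : Env → ℝ}
    (hg : Measurable g) (hh : Measurable h) (hk : Measurable k) :
    ∫ e, g (e []) * (h (subEnv [0] e) * k (subEnv [1] e)) ∂cascadeLaw μ =
      (∫ x, g x ∂μ) * ((∫ e, h e ∂cascadeLaw μ) * ∫ e, k e ∂cascadeLaw μ) := by
  have hmp := measurePreserving_branching (μ := μ) (show (0 : Fin 3) ≠ 1 by decide)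
  rw [← integral_prod_mul h k, ← integral_prod_mul g fun p : Env × Env => h p.1 * k p.2,
    ← hmp.map_eq]
  exact (integral_map hmp.measurable.aemeasurable ((hg.comp measurable_fst).mul
    ((hh.comp (measurable_fst.comp measurable_snd)).mul
      (hk.comp (measurable_snd.comp measurable_snd)))).aestronglyMeasurable).symm

/-- The increments of the resistance martingale. -/
def incr (n : ℕ) (e : Env) : ℝ := mart (n + 1) e - mart n e

theorem incr_succ (n : ℕ) (e : Env) :
    incr (n + 1) e = e [] 0 * incr n (subEnv [0] e) + e [] 1 * incr n (subEnv [1] e) := by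
  simp only [incr, mart]
  ring

theorem measurable_incr (n : ℕ) : Measurable (incr n) :=
  (measurable_mart (n + 1)).sub (measurable_mart n)

theorem abs_incr_le (n : ℕ) (e : Env) : |incr n e| ≤ 2 ^ (n + 1) := by
  have h1 := mart_nonneg n e
  have h2 := mart_nonneg (n + 1) e
  have h3 := mart_le n e
  have h4 := mart_le (n + 1) e
  have h5 : (2 : ℝ) ^ n ≤ 2 ^ (n + 1) := pow_le_pow_right₀ (by norm_num) (Nat.le_succ n)
  rw [incr, abs_le]
  constructor <;> linarith

theorem integrable_weight (a : Fin 3) :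
    Integrable (fun x : Fin 3 → unitInterval => (x a : ℝ)) μ :=
  integrable_of_abs_le (measurable_weight a) 1 fun x => by
    rw [abs_of_nonneg (x a).2.1]
    exact (x a).2.2

theorem integrable_weight_pow (a : Fin 3) (p : ℕ) :
    Integrable (fun x : Fin 3 → unitInterval => (x a : ℝ) ^ p) μ :=
  integrable_of_abs_le ((measurable_weight a).pow_const p) 1 fun x => by
    rw [abs_of_nonneg (pow_nonneg (x a).2.1 p)]
    exact pow_le_one₀ (x a).2.1 (x a).2.2

/-- Integrability of a bounded measurable function of the root weights and one subtree. -/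
theorem integrable_root_mul (a : Fin 3) {g : (Fin 3 → unitInterval) → ℝ} {h : Env → ℝ}
    (hg : Measurable g) (hh : Measurable h) {A B : ℝ} (hA : ∀ x, |g x| ≤ A)
    (hB : ∀ e, |h e| ≤ B) :
    Integrable (fun e : Env => g (e []) * h (subEnv [a] e)) (cascadeLaw μ) := by
  refine integrable_of_abs_le ((hg.comp (measurable_pi_apply _)).mul
    (hh.comp (measurable_subEnv _))) (A * B) fun e => ?_
  rw [abs_mul]
  exact mul_le_mul (hA _) (hB _) (abs_nonneg _) ((abs_nonneg _).trans (hA (e [])))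

theorem integral_incr (hA : ∫ x, ((x 0 : ℝ) + x 1) ∂μ = 1) (n : ℕ) :
    ∫ e, incr n e ∂cascadeLaw μ = 0 := by
  have habs : ∀ (a : Fin 3) (x : Fin 3 → unitInterval), |(x a : ℝ)| ≤ 1 := fun a x => by
    rw [abs_of_nonneg (x a).2.1]
    exact (x a).2.2
  induction n with
  | zero =>
    have h : ∀ a : Fin 3, ∫ e : Env, ((e [] a : ℝ)) ∂cascadeLaw μ = ∫ x, (x a : ℝ) ∂μ := fun a => by
      have := integral_root_mul (μ := μ) a (measurable_weight a)
        (measurable_const (a := (1 : ℝ)))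
      simpa using this
    have hi : ∀ a : Fin 3, Integrable (fun e : Env => (e [] a : ℝ)) (cascadeLaw μ) := fun a =>
      integrable_of_abs_le ((measurable_weight a).comp (measurable_pi_apply [])) 1
        fun e => habs a (e [])
    have hadd : Integrable (fun e : Env => (e [] 0 : ℝ) + e [] 1) (cascadeLaw μ) :=
      (hi 0).add (hi 1)
    simp only [incr, mart, mul_one]
    rw [integral_sub hadd (integrable_const _), integral_add (hi 0) (hi 1), h, h,
      ← integral_add (integrable_weight 0) (integrable_weight 1), hA]
    simp
  | succ n ih =>
    simp only [incr_succ]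
    have hi : ∀ a : Fin 3, Integrable (fun e : Env => (e [] a : ℝ) * incr n (subEnv [a] e))
        (cascadeLaw μ) := fun a =>
      integrable_root_mul a (measurable_weight a) (measurable_incr n) (habs a) (abs_incr_le n)
    have h : ∀ a : Fin 3, ∫ e : Env, (e [] a : ℝ) * incr n (subEnv [a] e) ∂cascadeLaw μ =
        (∫ x, (x a : ℝ) ∂μ) * ∫ e, incr n e ∂cascadeLaw μ := fun a =>
      integral_root_mul a (measurable_weight a) (measurable_incr n)
    rw [integral_add (hi 0) (hi 1), h, h, ih]
    simp

/-- The increments are orthogonal along different subtrees, so that their second moments decay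
geometrically. -/
theorem integral_incr_sq (hA : ∫ x, ((x 0 : ℝ) + x 1) ∂μ = 1) {q : ℝ}
    (hqx : ∫ x, ((x 0 : ℝ) ^ 2 + (x 1 : ℝ) ^ 2) ∂μ = q) (n : ℕ) :
    ∫ e, incr n e ^ 2 ∂cascadeLaw μ = q ^ n * ∫ e, incr 0 e ^ 2 ∂cascadeLaw μ := by
  induction n with
  | zero => simp
  | succ n ih =>
    have hm := measurable_incr n
    have hsq : ∀ e, |incr n e ^ 2| ≤ (2 ^ (n + 1)) ^ 2 := fun e => by
      rw [abs_pow]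
      exact pow_le_pow_left₀ (abs_nonneg _) (abs_incr_le n e) 2
    have hw2 : ∀ (a : Fin 3) (x : Fin 3 → unitInterval), |(x a : ℝ) ^ 2| ≤ 1 := fun a x => by
      rw [abs_of_nonneg (sq_nonneg _)]
      exact pow_le_one₀ (x a).2.1 (x a).2.2
    have hi : ∀ a : Fin 3, Integrable
        (fun e : Env => (e [] a : ℝ) ^ 2 * incr n (subEnv [a] e) ^ 2) (cascadeLaw μ) := fun a =>
      integrable_root_mul a ((measurable_weight a).pow_const 2) (hm.pow_const 2) (hw2 a) hsq
    have h : ∀ a : Fin 3, ∫ e : Env, (e [] a : ℝ) ^ 2 * incr n (subEnv [a] e) ^ 2 ∂cascadeLaw μ =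
        (∫ x, (x a : ℝ) ^ 2 ∂μ) * ∫ e, incr n e ^ 2 ∂cascadeLaw μ := fun a =>
      integral_root_mul a ((measurable_weight a).pow_const 2) (hm.pow_const 2)
    have hmg : Measurable fun x : Fin 3 → unitInterval => 2 * ((x 0 : ℝ) * x 1) :=
      ((measurable_weight 0).mul (measurable_weight 1)).const_mul 2
    have hcross : ∫ e : Env, 2 * ((e [] 0 : ℝ) * e [] 1) *
        (incr n (subEnv [0] e) * incr n (subEnv [1] e)) ∂cascadeLaw μ = 0 := by
      rw [integral_root_mul_mul (μ := μ) hmg hm hm, integral_incr hA]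
      simp
    have hic : Integrable (fun e : Env => 2 * ((e [] 0 : ℝ) * e [] 1) *
        (incr n (subEnv [0] e) * incr n (subEnv [1] e))) (cascadeLaw μ) := by
      refine integrable_of_abs_le ((hmg.comp (measurable_pi_apply [])).mul
        ((hm.comp (measurable_subEnv _)).mul (hm.comp (measurable_subEnv _))))
        (2 * (2 ^ (n + 1) * 2 ^ (n + 1))) fun e => ?_
      have h01 : |2 * ((e [] 0 : ℝ) * e [] 1)| ≤ 2 := by
        have := mul_le_one₀ (e [] 0).2.2 (e [] 1).2.1 (e [] 1).2.2
        have h0 := mul_nonneg (e [] 0).2.1 (e [] 1).2.1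
        rw [abs_of_nonneg (by linarith)]
        linarith
      rw [abs_mul, abs_mul (incr _ _)]
      gcongr
      exacts [abs_incr_le n _, abs_incr_le n _]
    have e1 : ∀ e, incr (n + 1) e ^ 2 = (e [] 0 : ℝ) ^ 2 * incr n (subEnv [0] e) ^ 2 +
        (e [] 1 : ℝ) ^ 2 * incr n (subEnv [1] e) ^ 2 + 2 * ((e [] 0 : ℝ) * e [] 1) *
        (incr n (subEnv [0] e) * incr n (subEnv [1] e)) := fun e => by
      rw [incr_succ]
      ring
    have hadd : Integrable (fun e : Env => (e [] 0 : ℝ) ^ 2 * incr n (subEnv [0] e) ^ 2 +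
        (e [] 1 : ℝ) ^ 2 * incr n (subEnv [1] e) ^ 2) (cascadeLaw μ) := (hi 0).add (hi 1)
    simp only [e1]
    rw [integral_add hadd hic, integral_add (hi 0) (hi 1), hcross, h, h, ih,
      ← hqx, integral_add (integrable_weight_pow 0 2) (integrable_weight_pow 1 2)]
    ring

theorem ae_exists_tendsto_mart (hA : ∫ x, ((x 0 : ℝ) + x 1) ∂μ = 1) {q : ℝ} (hq : q < 1)
    (hq0 : 0 ≤ q) (hqx : ∫ x, ((x 0 : ℝ) ^ 2 + (x 1 : ℝ) ^ 2) ∂μ = q) :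
    ∀ᵐ e ∂cascadeLaw μ, ∃ r, Tendsto (fun n => mart n e) atTop (𝓝 r) := by
  set s := (1 + q) / 2 with hs
  have hs0 : 0 < s := by rw [hs]; linarith
  have hs1 : s < 1 := by rw [hs]; linarith
  have hqs : q ≤ s ^ 2 := by
    rw [hs]
    nlinarith [sq_nonneg (1 - q)]
  set C := ∫ e, incr 0 e ^ 2 ∂cascadeLaw μ with hC
  have hC0 : 0 ≤ C := integral_nonneg fun e => sq_nonneg _
  have hmean : ∀ n, ∫ e, |incr n e| ∂cascadeLaw μ ≤ (1 + C) * s ^ n := by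
    intro n
    have hi : Integrable (fun e => incr n e ^ 2) (cascadeLaw μ) :=
      integrable_of_abs_le ((measurable_incr n).pow_const 2) ((2 ^ (n + 1)) ^ 2) fun e => by
        rw [abs_pow]
        exact pow_le_pow_left₀ (abs_nonneg _) (abs_incr_le n e) 2
    have hsn : 0 < s ^ n := pow_pos hs0 n
    calc ∫ e, |incr n e| ∂cascadeLaw μ
        ≤ ∫ e, (s ^ n + (s ^ n)⁻¹ * incr n e ^ 2) ∂cascadeLaw μ := by
          refine integral_mono_of_nonneg (Eventually.of_forall fun e => abs_nonneg _)
            ((integrable_const _).add (hi.const_mul _)) (Eventually.of_forall fun e => ?_)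
          change |incr n e| ≤ s ^ n + (s ^ n)⁻¹ * incr n e ^ 2
          rw [← sub_nonneg]
          have : s ^ n + (s ^ n)⁻¹ * incr n e ^ 2 - |incr n e| =
              (s ^ n)⁻¹ * ((s ^ n - |incr n e| / 2) ^ 2 + 3 / 4 * |incr n e| ^ 2) := by
            rw [← sq_abs (incr n e)]
            field_simp
            ring
          rw [this]
          positivity
      _ = s ^ n + (s ^ n)⁻¹ * (q ^ n * C) := by
          rw [integral_add (integrable_const _) (hi.const_mul _), integral_const_mul,
            integral_incr_sq hA hqx, ← hC]
          simp
      _ ≤ s ^ n + (s ^ n)⁻¹ * ((s ^ 2) ^ n * C) := by gcongr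
      _ = (1 + C) * s ^ n := by
          rw [← pow_mul, mul_comm 2 n, pow_mul]
          field_simp
  have hlin : ∫⁻ e, ∑' n, ENNReal.ofReal |incr n e| ∂cascadeLaw μ ≠ ⊤ := by
    rw [lintegral_tsum fun n =>
      ((measurable_incr n).abs.ennreal_ofReal).aemeasurable]
    have h1 : ∀ n, ∫⁻ e, ENNReal.ofReal |incr n e| ∂cascadeLaw μ ≤
        ENNReal.ofReal ((1 + C) * s ^ n) := fun n => by
      rw [← ofReal_integral_eq_lintegral_ofReal
        (integrable_of_abs_le (measurable_incr n).abs (2 ^ (n + 1)) fun e => by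
          rw [abs_abs]
          exact abs_incr_le n e) (Eventually.of_forall fun e => abs_nonneg _)]
      exact ENNReal.ofReal_le_ofReal (hmean n)
    refine ne_top_of_le_ne_top ?_ (ENNReal.tsum_le_tsum h1)
    have hsum : Summable fun n : ℕ => (1 + C) * s ^ n :=
      (summable_geometric_of_lt_one hs0.le hs1).mul_left _
    rw [← ENNReal.ofReal_tsum_of_nonneg (fun n => by positivity) hsum]
    exact ENNReal.ofReal_ne_top
  have hmeas : Measurable fun e => ∑' n, ENNReal.ofReal |incr n e| :=
    Measurable.tsum fun n => (measurable_incr n).abs.ennreal_ofReal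
  filter_upwards [ae_lt_top hmeas hlin] with e he
  have hsum : Summable fun n => |incr n e| := by
    have := ENNReal.summable_toReal he.ne
    simpa [ENNReal.toReal_ofReal (abs_nonneg _)] using this
  refine cauchySeq_tendsto_of_complete (cauchySeq_of_summable_dist (hsum.congr fun n => ?_))
  rw [dist_comm, Real.dist_eq]
  rfl

/-- The limit vanishes if and only if both limits one level below vanish, so it vanishes with
probability `0` or `1`; the exponential moments exclude probability `1`. -/
theorem ae_not_tendsto_mart_zero (hA : ∫ x, ((x 0 : ℝ) + x 1) ∂μ = 1) {q : ℝ} (hq : q < 1)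
    (hq0 : 0 ≤ q) (hqx : ∫ x, ((x 0 : ℝ) ^ 2 + (x 1 : ℝ) ^ 2) ∂μ = q)
    (hne : ∀ a, ∀ᵐ x ∂μ, (x a : ℝ) ≠ 0) :
    ∀ᵐ e ∂cascadeLaw μ, ¬ Tendsto (fun n => mart n e) atTop (𝓝 0) := by
  set N : Set Env := {e | Tendsto (fun n => mart n e) atTop (𝓝 0)}
  have hNm : MeasurableSet N := measurableSet_tendsto _ measurable_mart
  have hroot : MeasurePreserving (fun e : Env => e []) (cascadeLaw μ) μ :=
    measurePreserving_eval_infinitePi _ _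
  have hiff : ∀ᵐ e ∂cascadeLaw μ, e ∈ N ↔ (subEnv [0] e, subEnv [1] e) ∈ N ×ˢ N := by
    filter_upwards [hroot.quasiMeasurePreserving.ae (hne 0),
      hroot.quasiMeasurePreserving.ae (hne 1)] with e h0 h1
    have hpos : ∀ a, (e [] a : ℝ) ≠ 0 → 0 < (e [] a : ℝ) := fun a h => lt_of_le_of_ne
      (e [] a).2.1 (Ne.symm h)
    have key : ∀ a : Fin 3, (e [] a : ℝ) ≠ 0 →
        (∀ n, (e [] a : ℝ) * mart n (subEnv [a] e) ≤ mart (n + 1) e) → e ∈ N →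
        subEnv [a] e ∈ N := by
      intro a ha hle he
      have h2 := ((tendsto_add_atTop_iff_nat 1).2 he).const_mul ((e [] a : ℝ)⁻¹)
      rw [mul_zero] at h2
      refine squeeze_zero (fun n => mart_nonneg n _) (fun n => ?_) h2
      rw [inv_mul_eq_div, le_div_iff₀ (hpos a ha), mul_comm]
      exact hle n
    constructor
    · intro he
      refine ⟨key 0 h0 (fun n => ?_) he, key 1 h1 (fun n => ?_) he⟩
      · exact le_add_of_nonneg_right (mul_nonneg (e [] 1).2.1 (mart_nonneg _ _))
      · exact le_add_of_nonneg_left (mul_nonneg (e [] 0).2.1 (mart_nonneg _ _))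
    · rintro ⟨h2, h3⟩
      refine (tendsto_add_atTop_iff_nat 1).1 ?_
      have := (Tendsto.const_mul (e [] 0 : ℝ) h2).add (Tendsto.const_mul (e [] 1 : ℝ) h3)
      simpa [mart] using this
  have hsq : cascadeLaw μ N = cascadeLaw μ N * cascadeLaw μ N := by
    have hmp := measurePreserving_subEnv_prod (μ := μ) (show (0 : Fin 3) ≠ 1 by decide)
    calc cascadeLaw μ N
        = cascadeLaw μ ((fun e : Env => (subEnv [0] e, subEnv [1] e)) ⁻¹' (N ×ˢ N)) :=
          measure_congr (hiff.mono fun e he => propext he)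
      _ = cascadeLaw μ N * cascadeLaw μ N := by
          rw [hmp.measure_preimage (hNm.prod hNm).nullMeasurableSet, Measure.prod_prod]
  suffices h0 : cascadeLaw μ N = 0 from measure_eq_zero_iff_ae_notMem.1 h0
  by_contra h0
  have h1 : cascadeLaw μ N = 1 := by
    have := (ENNReal.mul_right_inj h0 (measure_ne_top _ N)).1 ((mul_one _).trans hsq)
    exact this.symm
  have hae : ∀ᵐ e ∂cascadeLaw μ, e ∈ N := mem_ae_iff.2 ((prob_compl_eq_zero_iff hNm).2 h1)
  set K := 4 / (1 - q)
  have hK : 0 < K := div_pos (by norm_num) (sub_pos.2 hq)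
  -- At `t = -(2K)⁻¹` the exponent `t + K t²` is negative.
  set t := -(2 * K)⁻¹ with ht
  have ht0 : 0 < (2 * K)⁻¹ := by positivity
  have htK : K * |t| ≤ 1 := by
    rw [ht, abs_neg, abs_of_pos ht0]
    field_simp
    norm_num
  have hneg : t + K * t ^ 2 < 0 := by
    have : t + K * t ^ 2 = -(4 * K)⁻¹ := by
      rw [ht]
      field_simp
      ring
    rw [this]
    have : 0 < (4 * K)⁻¹ := by positivity
    linarith
  have hmexp : ∀ n, Measurable fun e => Real.exp (t * mart n e) := fun n =>
    Real.measurable_exp.comp ((measurable_mart n).const_mul t)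
  have hb : ∀ n e, ‖Real.exp (t * mart n e)‖ ≤ 1 := fun n e => by
    rw [Real.norm_eq_abs, abs_of_pos (Real.exp_pos _), Real.exp_le_one_iff, ht]
    have := mul_nonneg ht0.le (mart_nonneg n e)
    linarith
  have hlim : Tendsto (fun n => ∫ e, Real.exp (t * mart n e) ∂cascadeLaw μ) atTop
      (𝓝 (∫ _, (1 : ℝ) ∂cascadeLaw μ)) := by
    refine tendsto_integral_of_dominated_convergence (fun _ => 1)
      (fun n => (hmexp n).aestronglyMeasurable) (integrable_const _)
      (fun n => Eventually.of_forall (hb n)) (hae.mono fun e he => ?_)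
    have := (Real.continuous_exp.tendsto _).comp (Tendsto.const_mul t he)
    simpa [Function.comp_def] using this
  rw [integral_const, probReal_univ, one_smul] at hlim
  have hle := le_of_tendsto' hlim fun n => integral_exp_mart_le hA hq hq0 hqx n htK
  have := Real.exp_lt_exp.2 hneg
  rw [Real.exp_zero] at this
  exact absurd this (not_lt.2 hle)

/-! ### Geometric decay of the edge lengths -/

/-- The product of the weights along a word. -/
def ell (e : Env) : Word → ℝ
  | [] => 1
  | a :: i => e [] a * ell (subEnv [a] e) i

theorem ell_nonneg (e : Env) (i : Word) : 0 ≤ ell e i := by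
  induction i generalizing e with
  | nil => exact zero_le_one
  | cons a i ih => exact mul_nonneg (e [] a).2.1 (ih _)

/-- The sum over the words `i` of length `m` of the `p`-th powers of the approximate edge lengths
`ell e i * mart n (subEnv i e)`. -/
def powerSum (p n : ℕ) : ℕ → Env → ℝ
  | 0, e => mart n e ^ p
  | m + 1, e => ∑ a : Fin 3, (e [] a : ℝ) ^ p * powerSum p n m (subEnv [a] e)

theorem powerSum_nonneg (p n m : ℕ) (e : Env) : 0 ≤ powerSum p n m e := by
  induction m generalizing e with
  | zero => exact pow_nonneg (mart_nonneg _ _) _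
  | succ m ih => exact Finset.sum_nonneg fun a _ => mul_nonneg (pow_nonneg (e [] a).2.1 _) (ih _)

theorem powerSum_le (p n m : ℕ) (e : Env) : powerSum p n m e ≤ 3 ^ m * (2 ^ n) ^ p := by
  induction m generalizing e with
  | zero =>
    simpa [powerSum] using pow_le_pow_left₀ (mart_nonneg _ _) (mart_le n e) p
  | succ m ih =>
    have h : ∀ a : Fin 3, (e [] a : ℝ) ^ p * powerSum p n m (subEnv [a] e) ≤
        3 ^ m * (2 ^ n) ^ p := fun a =>
      (mul_le_of_le_one_left (powerSum_nonneg _ _ _ _)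
        (pow_le_one₀ (e [] a).2.1 (e [] a).2.2)).trans (ih _)
    refine (Finset.sum_le_sum fun a _ => h a).trans (le_of_eq ?_)
    simp [pow_succ]
    ring

theorem measurable_powerSum (p n m : ℕ) : Measurable (powerSum p n m) := by
  induction m with
  | zero => exact (measurable_mart n).pow_const p
  | succ m ih =>
    refine Finset.measurable_fun_sum _ fun a _ => ?_
    exact (((measurable_weight a).comp (measurable_pi_apply [])).pow_const p).mul
      (ih.comp (measurable_subEnv [a]))

theorem pow_le_powerSum (p n : ℕ) (i : Word) (e : Env) :
    (ell e i * mart n (subEnv i e)) ^ p ≤ powerSum p n i.length e := by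
  induction i generalizing e with
  | nil => exact le_of_eq (by rw [ell, one_mul]; rfl)
  | cons a i ih =>
    calc (ell e (a :: i) * mart n (subEnv (a :: i) e)) ^ p
        = (e [] a : ℝ) ^ p * (ell (subEnv [a] e) i * mart n (subEnv i (subEnv [a] e))) ^ p := by
          rw [← mul_pow, ← mul_assoc]
          rfl
      _ ≤ (e [] a : ℝ) ^ p * powerSum p n i.length (subEnv [a] e) :=
          mul_le_mul_of_nonneg_left (ih _) (pow_nonneg (e [] a).2.1 _)
      _ ≤ _ := Finset.single_le_sum
          (f := fun a : Fin 3 => (e [] a : ℝ) ^ p * powerSum p n i.length (subEnv [a] e))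
          (fun b _ => mul_nonneg (pow_nonneg (e [] b).2.1 _) (powerSum_nonneg _ _ _ _))
          (Finset.mem_univ a)

theorem integral_powerSum {p : ℕ} {ρ : ℝ} (hρ : ∫ x, ∑ a : Fin 3, (x a : ℝ) ^ p ∂μ = ρ)
    (n m : ℕ) : ∫ e, powerSum p n m e ∂cascadeLaw μ =
      ρ ^ m * ∫ e, mart n e ^ p ∂cascadeLaw μ := by
  induction m with
  | zero => simp [powerSum]
  | succ m ih =>
    have hw : ∀ (a : Fin 3) (x : Fin 3 → unitInterval), |(x a : ℝ) ^ p| ≤ 1 := fun a x => by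
      rw [abs_of_nonneg (pow_nonneg (x a).2.1 _)]
      exact pow_le_one₀ (x a).2.1 (x a).2.2
    simp only [powerSum]
    rw [integral_finsetSum _ fun a _ => integrable_root_mul (g := fun x => (x a : ℝ) ^ p) a
      ((measurable_weight a).pow_const p) (measurable_powerSum p n m) (hw a) fun e => by
        rw [abs_of_nonneg (powerSum_nonneg _ _ _ _)]
        exact powerSum_le p n m e]
    have h : ∀ a : Fin 3, ∫ e : Env, (e [] a : ℝ) ^ p * powerSum p n m (subEnv [a] e) ∂cascadeLaw μ
        = (∫ x, (x a : ℝ) ^ p ∂μ) * ∫ e, powerSum p n m e ∂cascadeLaw μ := fun a =>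
      integral_root_mul a ((measurable_weight a).pow_const p) (measurable_powerSum p n m)
    simp only [h]
    rw [← Finset.sum_mul, ← integral_finsetSum _ fun a _ => integrable_weight_pow a p, hρ, ih]
    ring

/-- All moments of the martingale are bounded. -/
theorem exists_integral_mart_pow_le (hA : ∫ x, ((x 0 : ℝ) + x 1) ∂μ = 1) {q : ℝ} (hq : q < 1)
    (hq0 : 0 ≤ q) (hqx : ∫ x, ((x 0 : ℝ) ^ 2 + (x 1 : ℝ) ^ 2) ∂μ = q) (p : ℕ) :
    ∃ C, ∀ n, ∫ e, mart n e ^ p ∂cascadeLaw μ ≤ C := by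
  set K := 4 / (1 - q)
  have hK : 0 < K := div_pos (by norm_num) (sub_pos.2 hq)
  set t := K⁻¹ with ht
  have ht0 : 0 < t := by positivity
  have htK : K * |t| ≤ 1 := by
    rw [abs_of_pos ht0, ht, mul_inv_cancel₀ hK.ne']
  refine ⟨p.factorial / t ^ p * Real.exp (t + K * t ^ 2), fun n => ?_⟩
  calc ∫ e, mart n e ^ p ∂cascadeLaw μ
      ≤ ∫ e, p.factorial / t ^ p * Real.exp (t * mart n e) ∂cascadeLaw μ := by
        refine integral_mono_of_nonneg (Eventually.of_forall fun e =>
          pow_nonneg (mart_nonneg _ _) _) (Integrable.const_mul ?_ _) (Eventually.of_forall fun e =>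
            ?_)
        · refine integrable_of_abs_le (Real.measurable_exp.comp ((measurable_mart n).const_mul t))
            (Real.exp (t * 2 ^ n)) fun e => ?_
          rw [abs_of_pos (Real.exp_pos _)]
          exact Real.exp_le_exp.2 (mul_le_mul_of_nonneg_left (mart_le n e) ht0.le)
        · have := Real.pow_div_factorial_le_exp (t * mart n e)
            (mul_nonneg ht0.le (mart_nonneg _ _)) p
          have hf : (0 : ℝ) < p.factorial := by exact_mod_cast p.factorial_pos
          rw [div_le_iff₀ hf, mul_pow] at this
          change mart n e ^ p ≤ p.factorial / t ^ p * Real.exp (t * mart n e)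
          rw [div_mul_eq_mul_div, le_div_iff₀ (by positivity)]
          linarith
    _ = p.factorial / t ^ p * ∫ e, Real.exp (t * mart n e) ∂cascadeLaw μ := integral_const_mul _ _
    _ ≤ _ := mul_le_mul_of_nonneg_left (integral_exp_mart_le hA hq hq0 hqx n htK) (by positivity)

/-- If the expected sum of the `p`-th powers of the weights is less than `θ ^ p`, then almost surely
all edge lengths at level `m` are at most of order `θ ^ m`: the `p`-th powers of the approximate
edge lengths, divided by `θ ^ (p m)`, have a bounded expected sum, and Fatou's lemma applies. -/
theorem ae_exists_ell_mul_le (hA : ∫ x, ((x 0 : ℝ) + x 1) ∂μ = 1) {q : ℝ} (hq : q < 1)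
    (hq0 : 0 ≤ q) (hqx : ∫ x, ((x 0 : ℝ) ^ 2 + (x 1 : ℝ) ^ 2) ∂μ = q) {p : ℕ} (hp : p ≠ 0)
    {ρ θ : ℝ} (hρ : ∫ x, ∑ a : Fin 3, (x a : ℝ) ^ p ∂μ = ρ) (hθ : 0 < θ) (hρθ : ρ < θ ^ p) :
    ∀ᵐ e ∂cascadeLaw μ, ∃ C, ∀ i r, Tendsto (fun n => mart n (subEnv i e)) atTop (𝓝 r) →
      ell e i * r ≤ C * θ ^ i.length := by
  obtain ⟨C, hC⟩ := exists_integral_mart_pow_le hA hq hq0 hqx p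
  have hθp : 0 < θ ^ p := pow_pos hθ p
  have hρ0 : 0 ≤ ρ := by
    rw [← hρ]
    exact integral_nonneg fun x => Finset.sum_nonneg fun a _ => pow_nonneg (x a).2.1 _
  set Z : ℕ → Env → ENNReal := fun n e =>
    ∑' m, ENNReal.ofReal (((θ ^ p) ^ m)⁻¹ * powerSum p n m e) with hZ
  have hmt : ∀ n m, Measurable fun e => ((θ ^ p) ^ m)⁻¹ * powerSum p n m e := fun n m =>
    (measurable_powerSum p n m).const_mul _
  have hZm : ∀ n, Measurable (Z n) := fun n => Measurable.tsum fun m => (hmt n m).ennreal_ofReal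
  have hgeo : Summable fun m : ℕ => C * (ρ / θ ^ p) ^ m :=
    (summable_geometric_of_lt_one (by positivity) ((div_lt_one hθp).2 hρθ)).mul_left C
  have hC0 : 0 ≤ C := (integral_nonneg fun e => pow_nonneg (mart_nonneg _ _) _).trans (hC 0)
  set B := ENNReal.ofReal (∑' m : ℕ, C * (ρ / θ ^ p) ^ m) with hB
  have hZint : ∀ n, ∫⁻ e, Z n e ∂cascadeLaw μ ≤ B := by
    intro n
    rw [hZ, lintegral_tsum fun m => (hmt n m).ennreal_ofReal.aemeasurable, hB,
      ENNReal.ofReal_tsum_of_nonneg (fun m => by positivity) hgeo]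
    refine ENNReal.tsum_le_tsum fun m => ?_
    have hnn : ∀ e, 0 ≤ ((θ ^ p) ^ m)⁻¹ * powerSum p n m e := fun e =>
      mul_nonneg (by positivity) (powerSum_nonneg _ _ _ _)
    rw [← ofReal_integral_eq_lintegral_ofReal ?_ (Eventually.of_forall hnn)]
    · refine ENNReal.ofReal_le_ofReal ?_
      rw [integral_const_mul, integral_powerSum hρ, div_pow]
      calc _ ≤ ((θ ^ p) ^ m)⁻¹ * (ρ ^ m * C) := by
            gcongr
            exact hC n
        _ = _ := by ring
    · refine integrable_of_abs_le (hmt n m) (((θ ^ p) ^ m)⁻¹ * (3 ^ m * (2 ^ n) ^ p)) fun e => ?_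
      rw [abs_of_nonneg (hnn e)]
      exact mul_le_mul_of_nonneg_left (powerSum_le p n m e) (by positivity)
  have hfatou : ∫⁻ e, liminf (fun n => Z n e) atTop ∂cascadeLaw μ ≠ ⊤ := by
    refine ne_top_of_le_ne_top (show B ≠ ⊤ from ENNReal.ofReal_ne_top)
      ((lintegral_liminf_le hZm).trans
      ((liminf_le_liminf (Eventually.of_forall hZint)).trans ?_))
    rw [liminf_const]
  filter_upwards [ae_lt_top (Measurable.liminf hZm) hfatou] with e he
  set b := (liminf (fun n => Z n e) atTop).toReal with hb
  refine ⟨max 1 b, fun i r hr => ?_⟩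
  have hr0 : 0 ≤ r := ge_of_tendsto' hr fun n => mart_nonneg n _
  have hy0 : 0 ≤ ell e i * r / θ ^ i.length :=
    div_nonneg (mul_nonneg (ell_nonneg e i) hr0) (by positivity)
  have hpow : (ell e i * r / θ ^ i.length) ^ p ≤ b := by
    rw [← ENNReal.ofReal_le_iff_le_toReal he.ne]
    have hlim : Tendsto (fun n => ENNReal.ofReal
        ((ell e i * mart n (subEnv i e) / θ ^ i.length) ^ p)) atTop
        (𝓝 (ENNReal.ofReal ((ell e i * r / θ ^ i.length) ^ p))) :=
      ENNReal.tendsto_ofReal (((hr.const_mul _).div_const _).pow p)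
    rw [← hlim.liminf_eq]
    refine liminf_le_liminf (Eventually.of_forall fun n => ?_)
    refine le_trans (ENNReal.ofReal_le_ofReal ?_) (ENNReal.le_tsum i.length)
    rw [div_pow, ← pow_mul, mul_comm i.length p, pow_mul, div_eq_inv_mul]
    exact mul_le_mul_of_nonneg_left (pow_le_powerSum p n i e) (by positivity)
  rw [← div_le_iff₀ (by positivity)]
  rcases le_total (ell e i * r / θ ^ i.length) 1 with h | h
  · exact h.trans (le_max_left _ _)
  · exact ((le_self_pow₀ h hp).trans hpow).trans (le_max_right _ _)

/-! ### Consequences of the hypotheses on the weights -/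

theorem integral_sq_lt_one (hA : ∫ x, ((x 0 : ℝ) + x 1) ∂μ = 1)
    (hne : ∀ a, ∀ᵐ x ∂μ, (x a : ℝ) ≠ 0) :
    ∫ x, ((x 0 : ℝ) ^ 2 + (x 1 : ℝ) ^ 2) ∂μ < 1 := by
  by_contra! hge
  have i1 : Integrable (fun x : Fin 3 → unitInterval => (x 0 : ℝ) + x 1) μ :=
    (integrable_weight 0).add (integrable_weight 1)
  have i2 : Integrable (fun x : Fin 3 → unitInterval => (x 0 : ℝ) ^ 2 + (x 1 : ℝ) ^ 2) μ :=
    (integrable_weight_pow 0 2).add (integrable_weight_pow 1 2)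
  have hsq : ∀ y : unitInterval, 0 ≤ (y : ℝ) - (y : ℝ) ^ 2 := fun y => by
    nlinarith [y.2.1, y.2.2]
  have hnn : ∀ x : Fin 3 → unitInterval,
      0 ≤ ((x 0 : ℝ) + x 1) - ((x 0 : ℝ) ^ 2 + (x 1 : ℝ) ^ 2) := fun x => by
    linarith [hsq (x 0), hsq (x 1)]
  have h0 : ∫ x, (((x 0 : ℝ) + x 1) - ((x 0 : ℝ) ^ 2 + (x 1 : ℝ) ^ 2)) ∂μ = 0 := by
    refine le_antisymm ?_ (integral_nonneg hnn)
    rw [integral_sub i1 i2, hA]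
    linarith
  have h1 := (integral_eq_zero_iff_of_nonneg hnn (i1.sub i2)).1 h0
  -- Weights that equal their squares and are not `0` equal `1`.
  have h2 : ∫ x, ((x 0 : ℝ) + x 1) ∂μ = ∫ _, (2 : ℝ) ∂μ := by
    refine integral_congr_ae ?_
    filter_upwards [h1, hne 0, hne 1] with x hx hx0 hx1
    simp only [Pi.zero_apply] at hx
    have e0 : (x 0 : ℝ) * (1 - x 0) = 0 := by linarith [hsq (x 0), hsq (x 1)]
    have e1 : (x 1 : ℝ) * (1 - x 1) = 0 := by linarith [hsq (x 0), hsq (x 1)]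
    have f0 := (mul_eq_zero.1 e0).resolve_left hx0
    have f1 := (mul_eq_zero.1 e1).resolve_left hx1
    linarith
  rw [hA] at h2
  simp at h2

theorem exists_integral_pow_lt_one (hB : ∑ a : Fin 3, μ {x | (x a : ℝ) = 1} < 1) :
    ∃ p : ℕ, p ≠ 0 ∧ ∫ x, ∑ a : Fin 3, (x a : ℝ) ^ p ∂μ < 1 := by
  have hms : ∀ a : Fin 3, MeasurableSet {x : Fin 3 → unitInterval | (x a : ℝ) = 1} := fun a =>
    measurable_weight a (measurableSet_singleton 1)
  have hlim : Tendsto (fun p : ℕ => ∫ x, ∑ a : Fin 3, (x a : ℝ) ^ p ∂μ) atTop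
      (𝓝 (∑ a : Fin 3, μ.real {x | (x a : ℝ) = 1})) := by
    have h : ∀ p : ℕ, ∫ x, ∑ a : Fin 3, (x a : ℝ) ^ p ∂μ =
        ∑ a : Fin 3, ∫ x, (x a : ℝ) ^ p ∂μ := fun p =>
      integral_finsetSum _ fun a _ => integrable_weight_pow a p
    simp only [h]
    refine tendsto_finsetSum _ fun a _ => ?_
    rw [← integral_indicator_one (hms a)]
    refine tendsto_integral_of_dominated_convergence (fun _ => 1)
      (fun p => ((measurable_weight a).pow_const p).aestronglyMeasurable) (integrable_const _)
      (fun p => Eventually.of_forall fun x => ?_) (Eventually.of_forall fun x => ?_)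
    · rw [Real.norm_eq_abs, abs_of_nonneg (pow_nonneg (x a).2.1 p)]
      exact pow_le_one₀ (x a).2.1 (x a).2.2
    · by_cases hx : (x a : ℝ) = 1
      · have : x ∈ {x : Fin 3 → unitInterval | (x a : ℝ) = 1} := hx
        rw [Set.indicator_of_mem this]
        simp [hx]
      · have : x ∉ {x : Fin 3 → unitInterval | (x a : ℝ) = 1} := hx
        rw [Set.indicator_of_notMem this]
        exact tendsto_pow_atTop_nhds_zero_of_lt_one (x a).2.1 (lt_of_le_of_ne (x a).2.2 hx)
  have hlt : ∑ a : Fin 3, μ.real {x | (x a : ℝ) = 1} < 1 := by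
    have := (ENNReal.toReal_lt_toReal hB.ne_top ENNReal.one_ne_top).2 hB
    rwa [ENNReal.toReal_sum fun a _ => measure_ne_top _ _, ENNReal.toReal_one] at this
  obtain ⟨p, hp, hp0⟩ := ((hlim.eventually (gt_mem_nhds hlt)).and (eventually_ne_atTop 0)).exists
  exact ⟨p, hp0, hp⟩

theorem exists_lt_pow {ρ : ℝ} (hρ : ρ < 1) (p : ℕ) :
    ∃ θ : ℝ, 0 < θ ∧ θ < 1 ∧ ρ < θ ^ p := by
  have hlim : Tendsto (fun θ : ℝ => θ ^ p) (𝓝[<] 1) (𝓝 (1 ^ p)) :=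
    ((continuous_pow p).tendsto 1).mono_left nhdsWithin_le_nhds
  rw [one_pow] at hlim
  obtain ⟨θ, h1, h2, h3⟩ := ((hlim.eventually (lt_mem_nhds hρ)).and
    ((Ioo_mem_nhdsLT (show (0 : ℝ) < 1 by norm_num)))).exists
  exact ⟨θ, h2, h3, h1⟩

/-- Almost surely all limits of the resistance martingale exist and are positive, the weights do
not vanish, and the edge lengths decay geometrically. -/
theorem ae_cascadeLaw (hA : ∫ x, ((x 0 : ℝ) + x 1) ∂μ = 1) (hne : ∀ a, ∀ᵐ x ∂μ, (x a : ℝ) ≠ 0)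
    (hB : ∑ a : Fin 3, μ {x | (x a : ℝ) = 1} < 1) :
    ∀ᵐ e ∂cascadeLaw μ,
      (∀ i, ∃ r, 0 < r ∧ Tendsto (fun n => mart n (subEnv i e)) atTop (𝓝 r)) ∧
      (∀ i a, (e i a : ℝ) ≠ 0) ∧
      ∃ C θ : ℝ, 0 ≤ θ ∧ θ < 1 ∧ ∀ i r, Tendsto (fun n => mart n (subEnv i e)) atTop (𝓝 r) →
        ell e i * r ≤ C * θ ^ i.length := by
  have hq := integral_sq_lt_one hA hne
  have hq0 : 0 ≤ ∫ x, ((x 0 : ℝ) ^ 2 + (x 1 : ℝ) ^ 2) ∂μ := integral_nonneg fun x => by positivity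
  obtain ⟨p, hp, hρ⟩ := exists_integral_pow_lt_one hB
  obtain ⟨θ, hθ0, hθ1, hρθ⟩ := exists_lt_pow hρ p
  have h1 := ae_exists_tendsto_mart hA hq hq0 rfl
  have h2 := ae_not_tendsto_mart_zero hA hq hq0 rfl hne
  have h12 : ∀ i, ∀ᵐ e ∂cascadeLaw μ,
      ∃ r, 0 < r ∧ Tendsto (fun n => mart n (subEnv i e)) atTop (𝓝 r) := fun i => by
    filter_upwards [(measurePreserving_subEnv i).quasiMeasurePreserving.ae h1,
      (measurePreserving_subEnv i).quasiMeasurePreserving.ae h2] with e ⟨r, hr⟩ h0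
    refine ⟨r, lt_of_le_of_ne (ge_of_tendsto' hr fun n => mart_nonneg n _) ?_, hr⟩
    rintro rfl
    exact h0 hr
  have h3 : ∀ i a, ∀ᵐ e ∂cascadeLaw μ, (e i a : ℝ) ≠ 0 := fun i a =>
    (measurePreserving_eval_infinitePi (fun _ : Word => μ) i).quasiMeasurePreserving.ae (hne a)
  filter_upwards [ae_all_iff.2 h12, ae_all_iff.2 fun i => ae_all_iff.2 (h3 i),
    ae_exists_ell_mul_le hA hq hq0 rfl hp rfl hθ0 hρθ] with e g1 g2 ⟨C, hC⟩
  exact ⟨g1, g2, C, θ, hθ0.le, hθ1, hC⟩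

/-! ### Transfer to the given probability space -/

theorem ell_append (e : Env) (i k : Word) : ell e (i ++ k) = ell e i * ell (subEnv i e) k := by
  induction i generalizing e with
  | nil => exact (one_mul _).symm
  | cons a i ih =>
    change (e [] a : ℝ) * ell (subEnv [a] e) (i ++ k) = e [] a * ell (subEnv [a] e) i * _
    rw [ih, mul_assoc]
    rfl

theorem subEnv_append (e : Env) (i k : Word) : subEnv (i ++ k) e = subEnv k (subEnv i e) :=
  funext fun m => congrArg e (List.append_assoc i k m)

theorem l_eq_ell {u : Word → ℝ} {e : Env} (h : ∀ i a, (e i a : ℝ) = u (i ++ [a])) (i : Word) :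
    l u i = ell e i := by
  induction i generalizing u e with
  | nil => simp [l, ell]
  | cons a i ih =>
    rw [ell, ← ih (u := fun k => u (a :: k)) (e := subEnv [a] e) fun k b => h (a :: k) b, l,
      List.length_cons, Finset.prod_range_succ', mul_comm, h [] a]
    rfl

theorem mart_eq_sum (n : ℕ) (e : Env) :
    mart n e = ∑ j : Fin n → Fin 2, ell e (List.ofFn fun k => (j k).castSucc) := by
  induction n generalizing e with
  | zero => simp [mart, ell]
  | succ n ih =>
    rw [← (Fin.consEquiv fun _ => Fin 2).sum_comp, Fintype.sum_prod_type, Fin.sum_univ_two, mart,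
      ih, ih, Finset.mul_sum, Finset.mul_sum]
    congr 1 <;> refine Finset.sum_congr rfl fun j _ => ?_ <;> simp [Fin.consEquiv, ell]

theorem resistanceSum_eq_mart {u : Word → ℝ} {e : Env} (h : ∀ i a, (e i a : ℝ) = u (i ++ [a]))
    {i : Word} (hi : ell e i ≠ 0) (n : ℕ) : resistanceSum u i n = mart n (subEnv i e) := by
  rw [resistanceSum, mart_eq_sum]
  refine Finset.sum_congr rfl fun j _ => ?_
  rw [l_eq_ell h, l_eq_ell h, ell_append, mul_div_cancel_left₀ _ hi]

theorem ell_ne_zero {e : Env} (h : ∀ i a, (e i a : ℝ) ≠ 0) (i : Word) : ell e i ≠ 0 := by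
  induction i generalizing e with
  | nil => exact one_ne_zero
  | cons a i ih => exact mul_ne_zero (h [] a) (ih fun k b => h (a :: k) b)

/-- Realisations for which the limits of the resistance martingale are positive and the edge
lengths decay geometrically have a consistent system of edge lengths. -/
theorem tendsto_and_edgeLengths {u : Word → ℝ} {e : Env}
    (h : ∀ i a, (e i a : ℝ) = u (i ++ [a])) (hne : ∀ i a, (e i a : ℝ) ≠ 0)
    (hlim : ∀ i, ∃ r, 0 < r ∧ Tendsto (fun n => mart n (subEnv i e)) atTop (𝓝 r))
    (hdecay : ∃ C θ : ℝ, 0 ≤ θ ∧ θ < 1 ∧ ∀ i r,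
      Tendsto (fun n => mart n (subEnv i e)) atTop (𝓝 r) → ell e i * r ≤ C * θ ^ i.length) :
    (∀ i, Tendsto (resistanceSum u i) atTop (𝓝 (resistancePert u i)) ∧ 0 < resistancePert u i) ∧
      EdgeLengths (edgeLength u) := by
  have hsum : ∀ i, resistanceSum u i = fun n => mart n (subEnv i e) := fun i =>
    funext fun n => resistanceSum_eq_mart h (ell_ne_zero hne i) n
  have hpert : ∀ i, Tendsto (fun n => mart n (subEnv i e)) atTop (𝓝 (resistancePert u i)) ∧
      0 < resistancePert u i := fun i => by
    obtain ⟨r, hr0, hr⟩ := hlim i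
    have : resistancePert u i = r := by
      rw [resistancePert, hsum]
      exact hr.limUnder_eq
    rw [this]
    exact ⟨hr, hr0⟩
  have hlen : ∀ i, edgeLength u i = ell e i * resistancePert u i := fun i => by
    rw [edgeLength, l_eq_ell h]
  refine ⟨fun i => ⟨(hsum i).symm ▸ (hpert i).1, (hpert i).2⟩, ?_, ?_, ?_⟩
  · intro i
    rw [hlen]
    exact mul_pos (lt_of_le_of_ne (ell_nonneg e i) (Ne.symm (ell_ne_zero hne i))) (hpert i).2
  · intro i
    have hsucc : ∀ a : Fin 3, ell e (i ++ [a]) = ell e i * e i a := fun a => by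
      rw [ell_append]
      simp [ell, subEnv]
    have hrec : resistancePert u i = e i 0 * resistancePert u (i ++ [0]) +
        e i 1 * resistancePert u (i ++ [1]) := by
      refine tendsto_nhds_unique ((tendsto_add_atTop_iff_nat 1).2 (hpert i).1) ?_
      have hi : e i = subEnv i e [] := congrArg e (List.append_nil i).symm
      have := ((hpert (i ++ [0])).1.const_mul (e i 0 : ℝ)).add
        ((hpert (i ++ [1])).1.const_mul (e i 1 : ℝ))
      refine this.congr fun n => ?_
      rw [mart, subEnv_append, subEnv_append, hi]
    rw [hlen, hlen, hlen, hsucc, hsucc, hrec]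
    ring
  · obtain ⟨C, θ, h0, h1, hC⟩ := hdecay
    exact ⟨C, θ, h0, h1, fun i => (hlen i).trans_le (hC i _ (hpert i).1)⟩

/-- The weights of a cascade, gathered into a realisation on the canonical space. -/
def toEnv {Ω : Type*} [MeasurableSpace Ω] {P : Measure Ω} {w : Word → Ω → ℝ}
    (hw : IsMultiplicativeCascade P w) (ω : Ω) : Env :=
  fun i a => ⟨w (i ++ [a]) ω, hw.mem_Icc _ (by simp) ω⟩

theorem measurable_toEnv {Ω : Type*} [MeasurableSpace Ω] {P : Measure Ω} {w : Word → Ω → ℝ}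
    (hw : IsMultiplicativeCascade P w) : Measurable (toEnv hw) :=
  measurable_pi_lambda _ fun i => measurable_pi_lambda _ fun a =>
    (hw.measurable (i ++ [a]) (by simp)).subtype_mk

theorem map_toEnv {Ω : Type*} [MeasurableSpace Ω] {P : Measure Ω} [IsProbabilityMeasure P]
    {w : Word → Ω → ℝ} (hw : IsMultiplicativeCascade P w)
    [IsProbabilityMeasure (P.map fun ω => toEnv hw ω [])] :
    P.map (toEnv hw) = cascadeLaw (P.map fun ω => toEnv hw ω []) := by
  -- The weights in `[0,1]` are a measurable function of the real-valued ones.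
  let g : (Fin 3 → ℝ) → Fin 3 → unitInterval := fun v a => Set.projIcc 0 1 zero_le_one (v a)
  have hg : Measurable g := measurable_pi_lambda _ fun a =>
    continuous_projIcc.measurable.comp (measurable_pi_apply a)
  have hcomp : ∀ i, (fun ω => toEnv hw ω i) = g ∘ offspring w i := fun i => by
    funext ω a
    exact (Set.projIcc_of_mem zero_le_one (hw.mem_Icc (i ++ [a]) (by simp) ω)).symm
  have hind : iIndepFun (fun i ω => toEnv hw ω i) P := by
    rw [show (fun i ω => toEnv hw ω i) = fun i => g ∘ offspring w i from funext hcomp]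
    exact hw.iIndepFun.comp (fun _ => g) fun _ => hg
  have hid : ∀ i, P.map (fun ω => toEnv hw ω i) = P.map fun ω => toEnv hw ω [] := fun i => by
    rw [hcomp, hcomp]
    exact ((hw.identDistrib i).comp hg).map_eq
  exact (hind.map_fun_eq_infinitePi_map fun i =>
    (measurable_pi_apply i).comp (measurable_toEnv hw)).trans
      (congrArg (fun ν : Word → Measure (Fin 3 → unitInterval) => Measure.infinitePi ν)
        (funext hid))

end RandomDendrite

end

theorem mainTheorem4 {Ω : Type*} [MeasurableSpace Ω] (P : Measure Ω) [IsProbabilityMeasure P]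
    (c : ℝ) (hc : c ∈ Set.Ioo (0 : ℝ) (1 / 2))
    (w : RandomDendrite.Word → Ω → ℝ)
    (hw : RandomDendrite.IsMultiplicativeCascade P w)
    (hw_ne : ∀ i : RandomDendrite.Word, i ≠ [] → ∀ᵐ ω ∂P, w i ω ≠ 0)
    (hA : ∫ ω, (w [0] ω + w [1] ω) ∂P = 1)
    (hB : ∑ i : Fin 3, P {ω | w [i] ω = 1} < 1) :
    ∀ᵐ ω ∂P,
      -- the resistance perturbations exist as limits in `(0, ∞)`
      (∀ i : RandomDendrite.Word,
        Tendsto (RandomDendrite.resistanceSum (fun k => w k ω) i) atTop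
          (𝓝 (RandomDendrite.resistancePert (fun k => w k ω) i)) ∧
        0 < RandomDendrite.resistancePert (fun k => w k ω) i) ∧
      -- `R*` is a metric on `V*`
      ∃ dstar : MetricSpace (RandomDendrite.Vstar c),
        (∀ x y, dstar.dist x y = RandomDendrite.Rstar c (fun k => w k ω) x y) ∧
        -- `R` is a metric on `T`, the limit of `R*` along all approximating sequences
        ∃ R : MetricSpace (RandomDendrite.T c),
          (∀ (x y : RandomDendrite.T c) (xs ys : ℕ → RandomDendrite.Vstar c),
            Tendsto (fun n => (xs n : RandomDendrite.Plane)) atTop (𝓝 (x : RandomDendrite.Plane)) →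
            Tendsto (fun n => (ys n : RandomDendrite.Plane)) atTop (𝓝 (y : RandomDendrite.Plane)) →
            Tendsto (fun n => RandomDendrite.Rstar c (fun k => w k ω) (xs n) (ys n)) atTop
              (𝓝 (R.dist x y))) ∧
          -- `R` induces the Euclidean topology of `T`
          RandomDendrite.metricTopology R =
            (instTopologicalSpaceSubtype : TopologicalSpace (RandomDendrite.T c)) ∧
          -- `(T, R)` is a compact dendrite
          @CompactSpace (RandomDendrite.T c) (RandomDendrite.metricTopology R) ∧
          @RandomDendrite.IsDendrite (RandomDendrite.T c) (RandomDendrite.metricTopology R) ∧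
          -- `(T, R)` is the completion of `(V*, R*)`
          RandomDendrite.IsCompletion dstar R
            (Set.inclusion (RandomDendrite.Vstar_subset_T hc)) := by
  have hm := RandomDendrite.measurable_toEnv hw
  have hm0 : Measurable fun ω => RandomDendrite.toEnv hw ω [] := (measurable_pi_apply []).comp hm
  set μ := P.map fun ω => RandomDendrite.toEnv hw ω [] with hμ
  have hμp : IsProbabilityMeasure μ := Measure.isProbabilityMeasure_map hm0.aemeasurable
  have hA' : ∫ x, ((x 0 : ℝ) + x 1) ∂μ = 1 := by
    have hs : Measurable fun x : Fin 3 → unitInterval => (x 0 : ℝ) + x 1 :=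
      (RandomDendrite.measurable_weight 0).add (RandomDendrite.measurable_weight 1)
    rw [hμ, integral_map hm0.aemeasurable hs.aestronglyMeasurable]
    exact hA
  have hms : ∀ (a : Fin 3) (y : ℝ), MeasurableSet {x : Fin 3 → unitInterval | (x a : ℝ) = y} :=
    fun a y => RandomDendrite.measurable_weight a (measurableSet_singleton y)
  have hne' : ∀ a, ∀ᵐ x ∂μ, (x a : ℝ) ≠ 0 := fun a =>
    (ae_map_iff hm0.aemeasurable (p := fun x => (x a : ℝ) ≠ 0) (hms a 0).compl).2
      (hw_ne [a] (by simp))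
  have hB' : ∑ a : Fin 3, μ {x | (x a : ℝ) = 1} < 1 := by
    refine (Finset.sum_congr rfl fun a _ => ?_).trans_lt hB
    rw [hμ, Measure.map_apply hm0 (hms a 1)]
    rfl
  have hae := RandomDendrite.ae_cascadeLaw hA' hne' hB'
  rw [← RandomDendrite.map_toEnv hw] at hae
  filter_upwards [ae_of_ae_map hm.aemeasurable hae] with ω ⟨h1, h2, h3⟩
  obtain ⟨h4, h5⟩ := RandomDendrite.tendsto_and_edgeLengths (u := fun k => w k ω)
    (e := RandomDendrite.toEnv hw ω) (fun _ _ => rfl) h2 h1 h3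
  exact ⟨h4, RandomDendrite.exists_metric_of_edgeLengths hc h5⟩
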